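/- Let $R$ be a commutative ring with unit, $n\ge 2$, $F_n$ a free group of rank $n$, $H=F_n^{\mathrm{ab}}\otimes_{\mathbb Z}R$, and $[\gamma]\in H$ the class of $\gamma\in F_n$. Put $H^*=\mathrm{Hom}_R(H,R)$ and identify $H^*\otimes H^{\otimes m}=\mathrm{Hom}_R(H,H^{\otimes m})$. The group $\mathrm{Aut}(F_n)$ acts on these modules through its action on $H$, and $F_n\rtimes \mathrm{Aut}(F_n)$ acts through the projection to $\mathrm{Aut}(F_n)$. Cup products are Alexander–Whitney products, $(f\cup g)(x_1,\dots,x_{a+b})=f(x_1,\dots,x_a)\otimes x_1\cdots x_a\,g(x_{a+1},\dots,x_{a+b})$. Let $k_0\in H^1(F_n\rtimes\mathrm{Aut}(F_n);H)$ be the class of the cocycle $(\gamma,\varphi)\mapsto[\gamma]$, and let $$\pi_\sharp:H^{p+1}(F_n\rtimes\mathrm{Aut}(F_n);H^{\otimes(p+1)})\to H^p(\mathrm{Aut}(F_n);H^1(F_n;H^{\otimes(p+1)}))=H^p(\mathrm{Aut}(F_n);H^*\otimes H^{\otimes(p+1)})$$ be the Gysin map (Hochschild–Serre edge map) of the extension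 $F_n\to F_n\rtimes\mathrm{Aut}(F_n)\to\mathrm{Aut}(F_n)$: if a class is represented by a normalized cocycle $f$ that vanishes whenever two of its arguments lie in $F_n$, then its image is represented by the cocycle $v$ with $$v(\varphi_1,\dots,\varphi_p)[\gamma]=\sum_{i=0}^{p}(-1)^i f\bigl(\varphi_1,\dots,\varphi_i,(\varphi_1\cdots\varphi_i)^{-1}(\gamma),\varphi_{i+1},\dots,\varphi_p\bigr).$$ For $p\ge 0$ put $h_p=\pi_\sharp(k_0^{\otimes(p+1)})\in H^p(\mathrm{Aut}(F_n);H^*\otimes H^{\otimes(p+1)})$. Let $S^0_p$ be the set of vertices of the Stasheff associahedron $K_{p+1}$, i.e. of full parenthesizations of a word of $p+1$ letters, so that $S^0_0=\{1\}$ and $S^0_p=\coprod_{q=0}^{p-1}S^0_q\times S^0_{p-q-1}$ for $p\ge1$; write $|w|=p$ for $w\in S^0_p$. Define $\mathrm{sgn}(w)\in\{\pm1\}$ and $h(w)\in H^p(\mathrm{Aut}(F_n);H^*\otimes H^{\otimes(p+1)})$ by $\mathrm{sgn}(1)=1$, $h(1)=1_H$ and, for $w=(w_1,w_2)$, $$\mathrm{sgn}(w)=(-1)^{|w_2|}\,\mathrm{sgn}(w_1)\,\mathrm{sgn}(w_2),\qquad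 h(w)=(h(w_1)\otimes h(w_2))\circ h_1,$$ the latter being the cup product $h(w_1)\cup h(w_2)\cup h_1$ with coefficients contracted by $(u,v,t)\mapsto(u\otimes v)\circ t$. **Proposition 4.3.** For every $p\ge0$, the above description determines one and only one class $h_p$, and $$h(w)=\mathrm{sgn}(w)\,h_p\in H^p(\mathrm{Aut}(F_n);H^*\otimes H^{\otimes(p+1)})\qquad\text{for every } w\in S^0_p .$$ -/

import Mathlib

universe u

noncomputable section

namespace KawazumiMagnus

open scoped TensorProduct

/-! ## Cohomology classes of inhomogeneous cochains -/

section Cohomology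

variable {R G : Type u} [CommRing R] [Group G]

/-- The coboundary of an inhomogeneous cochain, as a plain function:
`(d f)(g₀,…,gₙ) = g₀ f(g₁,…,gₙ) + ∑ⱼ (-1)^(j+1) f(…, gⱼ gⱼ₊₁, …) + (-1)^(n+1) f(g₀,…,gₙ₋₁)`. -/
def coboundary (A : Rep.{u} R G) (n : ℕ) (f : (Fin n → G) → A) : (Fin (n + 1) → G) → A :=
  inhomogeneousCochains.d A n f

/-- The class in `Hⁿ(G; A)` of a cochain `f` with `d f = 0`. -/
def cls {A : Rep.{u} R G} {n : ℕ} (f : (Fin n → G) → A) (h : coboundary A n f = 0) :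
    groupCohomology A n :=
  groupCohomology.π A n (groupCohomology.cocyclesMk f h)

/-- `f` is a cocycle whose class is `x`. -/
def Represents {A : Rep.{u} R G} {n : ℕ} (f : (Fin n → G) → A) (x : groupCohomology A n) : Prop :=
  ∃ h : coboundary A n f = 0, cls f h = x

theorem coboundary_apply (A : Rep.{u} R G) (n : ℕ) (f : (Fin n → G) → A) (g : Fin (n + 1) → G) :
    coboundary A n f g = A.ρ (g 0) (f fun i => g i.succ) +
      ∑ j : Fin (n + 1), (-1 : R) ^ ((j : ℕ) + 1) • f (Fin.contractNth j (· * ·) g) :=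
  inhomogeneousCochains.d_hom_apply A n f g

theorem coboundary_add (A : Rep.{u} R G) (n : ℕ) (f g : (Fin n → G) → A) :
    coboundary A n (f + g) = coboundary A n f + coboundary A n g :=
  map_add (inhomogeneousCochains.d A n).hom f g

theorem coboundary_sub (A : Rep.{u} R G) (n : ℕ) (f g : (Fin n → G) → A) :
    coboundary A n (f - g) = coboundary A n f - coboundary A n g :=
  map_sub (inhomogeneousCochains.d A n).hom f g

theorem iCocycles_injective (A : Rep.{u} R G) (n : ℕ) :
    Function.Injective (groupCohomology.iCocycles A n) :=
  (ModuleCat.mono_iff_injective (groupCohomology.iCocycles A n)).1 inferInstance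

theorem exists_represents {A : Rep.{u} R G} {n : ℕ} (x : groupCohomology A n) :
    ∃ f : (Fin n → G) → A, Represents f x := by
  induction x using groupCohomology_induction_on with
  | h z =>
    have hz : coboundary A n (groupCohomology.iCocycles A n z) = 0 := by
      have h := (groupCohomology.inhomogeneousCochains A).iCycles_d n (n + 1)
      rw [groupCohomology.inhomogeneousCochains.d_def] at h
      exact congrArg (fun t => t.hom z) h
    refine ⟨groupCohomology.iCocycles A n z, hz, ?_⟩
    have : groupCohomology.cocyclesMk (groupCohomology.iCocycles A n z) hz = z :=
      iCocycles_injective A n (groupCohomology.iCocycles_mk _ hz)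
    rw [cls, this]

theorem cls_sub {A : Rep.{u} R G} {n : ℕ} (f g : (Fin n → G) → A) (hf : coboundary A n f = 0)
    (hg : coboundary A n g = 0) (hfg : coboundary A n (f - g) = 0) :
    cls (f - g) hfg = cls f hf - cls g hg := by
  have h : groupCohomology.cocyclesMk (f - g) hfg =
      groupCohomology.cocyclesMk f hf - groupCohomology.cocyclesMk g hg := by
    apply iCocycles_injective A n
    rw [map_sub]
    exact (groupCohomology.iCocycles_mk _ hfg).trans
      (congrArg₂ (· - ·) (groupCohomology.iCocycles_mk _ hf)
        (groupCohomology.iCocycles_mk _ hg)).symm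
  rw [cls, cls, cls, h, map_sub]

/-- The class of a cocycle of positive degree vanishes exactly if it is a coboundary. -/
theorem cls_eq_zero_iff {A : Rep.{u} R G} {n : ℕ} (f : (Fin (n + 1) → G) → A)
    (hf : coboundary A (n + 1) f = 0) :
    cls f hf = 0 ↔ ∃ b : (Fin n → G) → A, coboundary A n b = f := by
  have key : ∀ b : (Fin n → G) → A, groupCohomology.iCocycles A (n + 1)
      (groupCohomology.toCocycles A n (n + 1) b) = coboundary A n b := by
    intro b
    have h := (groupCohomology.inhomogeneousCochains A).toCycles_i n (n + 1)
    rw [groupCohomology.inhomogeneousCochains.d_def] at h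
    exact congrArg (fun t => t.hom b) h
  have hex := CategoryTheory.ShortComplex.exact_of_g_is_cokernel
    (CategoryTheory.ShortComplex.mk _ _
      ((groupCohomology.inhomogeneousCochains A).toCycles_comp_homologyπ n (n + 1)))
    ((groupCohomology.inhomogeneousCochains A).homologyIsCokernel n (n + 1) (by simp))
  rw [CategoryTheory.ShortComplex.moduleCat_exact_iff] at hex
  constructor
  · intro h
    obtain ⟨b, hb⟩ := hex _ h
    refine ⟨b, ?_⟩
    rw [← key b]
    exact (congrArg (groupCohomology.iCocycles A (n + 1)) hb).trans
      (groupCohomology.iCocycles_mk _ hf)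
  · rintro ⟨b, rfl⟩
    have : groupCohomology.cocyclesMk (coboundary A n b) hf =
        groupCohomology.toCocycles A n (n + 1) b :=
      iCocycles_injective A (n + 1) ((groupCohomology.iCocycles_mk _ hf).trans (key b).symm)
    rw [cls, this]
    exact congrArg (fun t => t.hom b)
      ((groupCohomology.inhomogeneousCochains A).toCycles_comp_homologyπ n (n + 1))

theorem cls_of_eq_zero {A : Rep.{u} R G} {n : ℕ} (f : (Fin n → G) → A)
    (hf : coboundary A n f = 0) (h : f = 0) : cls f hf = 0 := by
  subst h
  have h2 : groupCohomology.cocyclesMk (0 : (Fin n → G) → A) hf = 0 :=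
    iCocycles_injective A n ((groupCohomology.iCocycles_mk _ hf).trans (map_zero _).symm)
  rw [cls, h2, map_zero]

/-- A cocycle of degree zero represents zero only if it is zero. -/
theorem cls_zero_eq_zero_iff {A : Rep.{u} R G} (f : (Fin 0 → G) → A)
    (hf : coboundary A 0 f = 0) : cls f hf = 0 ↔ f = 0 := by
  have hinj : Function.Injective (groupCohomology.π A 0) :=
    (ModuleCat.mono_iff_injective ((groupCohomology.inhomogeneousCochains A).homologyπ 0)).1
      inferInstance
  constructor
  · intro h
    have h2 : groupCohomology.cocyclesMk f hf = 0 := hinj (by rw [map_zero]; exact h)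
    have h3 := groupCohomology.iCocycles_mk f hf
    rw [h2, map_zero] at h3
    exact h3.symm
  · exact cls_of_eq_zero f hf

/-! ## The cup product -/

/-- The product `x₀ x₁ ⋯ x_{p-1}` of the first `p` terms of a sequence. -/
def seqProd (p : ℕ) (x : ℕ → G) : G := (List.ofFn fun i : Fin p => x i).prod

/-- The sequence `x₀, …, x_{j-1}, x_j x_{j+1}, x_{j+2}, …`. -/
def seqContract (j : ℕ) (x : ℕ → G) : ℕ → G := fun i =>
  if i < j then x i else if i = j then x i * x (i + 1) else x (i + 1)

theorem seqProd_succ (p : ℕ) (x : ℕ → G) :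
    seqProd (p + 1) x = x 0 * seqProd p (fun i => x (i + 1)) := by
  simp [seqProd, List.ofFn_succ]

theorem seqProd_succ' (p : ℕ) (x : ℕ → G) : seqProd (p + 1) x = seqProd p x * x p := by
  induction p generalizing x with
  | zero => simp [seqProd]
  | succ p ih => rw [seqProd_succ, ih, seqProd_succ p, mul_assoc]

theorem seqProd_contract_of_lt {j p : ℕ} (h : j < p) (x : ℕ → G) :
    seqProd p (seqContract j x) = seqProd (p + 1) x := by
  induction j generalizing p x with
  | zero =>
    obtain ⟨p, rfl⟩ : ∃ q, p = q + 1 := ⟨p - 1, by omega⟩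
    rw [seqProd_succ, seqProd_succ, seqProd_succ, ← mul_assoc]
    simp [seqContract]
  | succ j ih =>
    obtain ⟨p, rfl⟩ : ∃ q, p = q + 1 := ⟨p - 1, by omega⟩
    rw [seqProd_succ, seqProd_succ (p + 1), ← ih (by omega)]
    simp [seqContract]
    rfl

theorem seqProd_contract_of_le {j p : ℕ} (h : p ≤ j) (x : ℕ → G) :
    seqProd p (seqContract j x) = seqProd p x := by
  unfold seqProd
  congr 2
  funext i
  have : (i : ℕ) < j := by omega
  simp [seqContract, this]

theorem exists_seq {n : ℕ} (y : Fin n → G) : ∃ x : ℕ → G, y = fun i : Fin n => x i :=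
  ⟨fun i => if h : i < n then y ⟨i, h⟩ else 1, by funext i; simp⟩

theorem coboundary_seq (A : Rep.{u} R G) (n : ℕ) (f : (Fin n → G) → A) (x : ℕ → G) :
    coboundary A n f (fun i => x i) = A.ρ (x 0) (f fun i => x (i + 1)) +
      ∑ j ∈ Finset.range (n + 1), (-1 : R) ^ (j + 1) • f (fun i => seqContract j x i) := by
  rw [coboundary_apply, Finset.sum_range]
  congr 1

variable {A B C : Rep.{u} R G}

/-- The Alexander–Whitney cup product of cochains along a bilinear map `β : A × B → C`:
`(f ∪ g)(x₁,…,x_{p+q}) = β (f(x₁,…,x_p), x₁⋯x_p · g(x_{p+1},…,x_{p+q}))`. -/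
def cupFun (β : A →ₗ[R] B →ₗ[R] C) {p q : ℕ} (f : (Fin p → G) → A) (g : (Fin q → G) → B) :
    (Fin (p + q) → G) → C := fun x =>
  β (f fun i => x (Fin.castAdd q i))
    (B.ρ (List.ofFn fun i => x (Fin.castAdd q i)).prod (g fun j => x (Fin.natAdd p j)))

theorem cupFun_seq (β : A →ₗ[R] B →ₗ[R] C) {p q : ℕ} (f : (Fin p → G) → A)
    (g : (Fin q → G) → B) (x : ℕ → G) :
    cupFun β f g (fun i => x i) =
      β (f fun i => x i) (B.ρ (seqProd p x) (g fun j => x (p + j))) := rfl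

/-- The Leibniz rule `d(f ∪ g) = df ∪ g + (-1)^p f ∪ dg`. -/
theorem coboundary_cupFun (β : A →ₗ[R] B →ₗ[R] C)
    (hβ : ∀ g a b, β (A.ρ g a) (B.ρ g b) = C.ρ g (β a b)) {p q : ℕ}
    (f : (Fin p → G) → A) (g : (Fin q → G) → B) (x : ℕ → G) :
    coboundary C (p + q) (cupFun β f g) (fun i => x i) =
      β (coboundary A p f fun i => x i) (B.ρ (seqProd (p + 1) x) (g fun j => x (p + 1 + j))) +
      (-1 : R) ^ p • β (f fun i => x i)
        (B.ρ (seqProd p x) (coboundary B q g fun j => x (p + j))) := by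
  have e1 : ∀ j ∈ Finset.range p,
      (-1 : R) ^ (j + 1) • cupFun β f g (fun i => seqContract j x i) =
        β ((-1 : R) ^ (j + 1) • f fun i => seqContract j x i)
          (B.ρ (seqProd (p + 1) x) (g fun j => x (p + 1 + j))) := by
    intro j hj
    rw [Finset.mem_range] at hj
    rw [cupFun_seq, seqProd_contract_of_lt hj, map_smul, LinearMap.smul_apply]
    congr 5
    funext i
    have h1 : ¬ (p + (i : ℕ) < j) := by omega
    have h2 : ¬ (p + (i : ℕ) = j) := by omega
    simp only [seqContract, h1, h2, if_false]
    congr 1; omega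
  have e2 : ∀ j ∈ Finset.range (q + 1),
      (-1 : R) ^ (p + j + 1) • cupFun β f g (fun i => seqContract (p + j) x i) =
        (-1 : R) ^ p • β (f fun i => x i) (B.ρ (seqProd p x)
          ((-1 : R) ^ (j + 1) • g fun i => seqContract j (fun k => x (p + k)) i)) := by
    intro j _
    rw [cupFun_seq, seqProd_contract_of_le (by omega), map_smul, map_smul, smul_smul, ← pow_add,
      ← add_assoc]
    congr 3
    · congr 1
      funext i
      have : (i : ℕ) < p + j := by omega
      simp [seqContract, this]
    · congr 2
      funext i
      simp [seqContract, add_assoc]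
  have e3 : (f fun i => seqContract p x i) = f fun i => x i := by
    congr 1
    funext i
    simp [seqContract]
  rw [coboundary_seq C, coboundary_seq A, show p + q + 1 = p + (q + 1) by ring,
    Finset.sum_range_add, Finset.sum_congr rfl e1, Finset.sum_congr rfl e2,
    Finset.sum_range_succ _ p, e3, ← Finset.smul_sum, ← map_sum, ← map_sum, ← LinearMap.sum_apply,
    ← map_sum, coboundary_seq B (x := fun k => x (p + k)), cupFun_seq β f g (fun i => x (i + 1)),
    ← hβ]
  simp only [map_add, LinearMap.add_apply, smul_add, map_smul, LinearMap.smul_apply]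
  have e4 : B.ρ (x 0) (B.ρ (seqProd p fun i => x (i + 1)) (g fun j => x (p + (j : ℕ) + 1))) =
      B.ρ (seqProd (p + 1) x) (g fun j => x (p + 1 + j)) := by
    rw [seqProd_succ, map_mul]
    simp [add_right_comm]
  have e5 : B.ρ (seqProd p x) (B.ρ (x (p + 0)) (g fun j => x (p + ((j : ℕ) + 1)))) =
      B.ρ (seqProd (p + 1) x) (g fun j => x (p + 1 + j)) := by
    rw [seqProd_succ', map_mul]
    simp [add_assoc, add_comm 1]
  rw [e4, e5, pow_succ]
  module

theorem coboundary_cupFun_eq_zero (β : A →ₗ[R] B →ₗ[R] C)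
    (hβ : ∀ g a b, β (A.ρ g a) (B.ρ g b) = C.ρ g (β a b)) {p q : ℕ}
    {f : (Fin p → G) → A} {g : (Fin q → G) → B} (hf : coboundary A p f = 0)
    (hg : coboundary B q g = 0) : coboundary C (p + q) (cupFun β f g) = 0 := by
  funext y
  obtain ⟨x, rfl⟩ := exists_seq y
  rw [coboundary_cupFun β hβ, hf, hg]
  simp

/-- The cup product `Hᵖ(G; A) × H^q(G; B) → H^{p+q}(G; C)` along an equivariant bilinear map;
by `cup_cls` it is computed by any representatives. -/
def cup (β : A →ₗ[R] B →ₗ[R] C) (hβ : ∀ g a b, β (A.ρ g a) (B.ρ g b) = C.ρ g (β a b))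
    {p q : ℕ} (x : groupCohomology A p) (y : groupCohomology B q) :
    groupCohomology C (p + q) :=
  cls (cupFun β (exists_represents x).choose (exists_represents y).choose)
    (coboundary_cupFun_eq_zero β hβ (exists_represents x).choose_spec.choose
      (exists_represents y).choose_spec.choose)

theorem cls_eq_zero_of_seq {m n : ℕ} (hmn : n + 1 = m) (f : (Fin m → G) → A)
    (hf : coboundary A m f = 0) (b : (Fin n → G) → A)
    (h : ∀ x : ℕ → G, f (fun i => x i) = coboundary A n b fun i => x i) : cls f hf = 0 := by
  subst hmn
  rw [cls_eq_zero_iff]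
  refine ⟨b, ?_⟩
  funext y
  obtain ⟨x, rfl⟩ := exists_seq y
  exact (h x).symm

theorem cls_cupFun_left (β : A →ₗ[R] B →ₗ[R] C)
    (hβ : ∀ g a b, β (A.ρ g a) (B.ρ g b) = C.ρ g (β a b)) {p q : ℕ}
    (f : (Fin p → G) → A) (g : (Fin q → G) → B) (hf : coboundary A p f = 0)
    (hg : coboundary B q g = 0) (h0 : cls f hf = 0) :
    cls (cupFun β f g) (coboundary_cupFun_eq_zero β hβ hf hg) = 0 := by
  cases p with
  | zero =>
    rw [cls_zero_eq_zero_iff] at h0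
    subst h0
    exact cls_of_eq_zero _ _ (by funext x; simp [cupFun])
  | succ p =>
    obtain ⟨b, rfl⟩ := (cls_eq_zero_iff f hf).1 h0
    refine cls_eq_zero_of_seq (by omega : p + q + 1 = p + 1 + q) _ _ (cupFun β b g) fun x => ?_
    rw [coboundary_cupFun β hβ, hg, cupFun_seq]
    simp

theorem cls_cupFun_right (β : A →ₗ[R] B →ₗ[R] C)
    (hβ : ∀ g a b, β (A.ρ g a) (B.ρ g b) = C.ρ g (β a b)) {p q : ℕ}
    (f : (Fin p → G) → A) (g : (Fin q → G) → B) (hf : coboundary A p f = 0)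
    (hg : coboundary B q g = 0) (h0 : cls g hg = 0) :
    cls (cupFun β f g) (coboundary_cupFun_eq_zero β hβ hf hg) = 0 := by
  cases q with
  | zero =>
    rw [cls_zero_eq_zero_iff] at h0
    subst h0
    exact cls_of_eq_zero _ _ (by funext x; simp [cupFun])
  | succ q =>
    obtain ⟨b, rfl⟩ := (cls_eq_zero_iff g hg).1 h0
    refine cls_eq_zero_of_seq (by omega : p + q + 1 = p + (q + 1)) _ _
      ((-1 : R) ^ p • cupFun β f b) fun x => ?_
    have hs : coboundary C (p + q) ((-1 : R) ^ p • cupFun β f b) =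
        (-1 : R) ^ p • coboundary C (p + q) (cupFun β f b) :=
      map_smul (inhomogeneousCochains.d C _).hom _ _
    rw [hs, Pi.smul_apply, coboundary_cupFun β hβ, hf, cupFun_seq]
    simp [smul_smul, ← pow_add, ← two_mul]

theorem cls_cupFun_congr (β : A →ₗ[R] B →ₗ[R] C)
    (hβ : ∀ g a b, β (A.ρ g a) (B.ρ g b) = C.ρ g (β a b)) {p q : ℕ}
    (f f' : (Fin p → G) → A) (g g' : (Fin q → G) → B) (hf : coboundary A p f = 0)
    (hf' : coboundary A p f' = 0) (hg : coboundary B q g = 0) (hg' : coboundary B q g' = 0)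
    (ef : cls f' hf' = cls f hf) (eg : cls g' hg' = cls g hg) :
    cls (cupFun β f' g') (coboundary_cupFun_eq_zero β hβ hf' hg') =
      cls (cupFun β f g) (coboundary_cupFun_eq_zero β hβ hf hg) := by
  have hfd : coboundary A p (f' - f) = 0 := by rw [coboundary_sub, hf, hf', sub_self]
  have hgd : coboundary B q (g' - g) = 0 := by rw [coboundary_sub, hg, hg', sub_self]
  have d1 := cls_cupFun_left β hβ (f' - f) g' hfd hg' (by rw [cls_sub _ _ hf' hf, ef, sub_self])
  have d2 := cls_cupFun_right β hβ f (g' - g) hf hgd (by rw [cls_sub _ _ hg' hg, eg, sub_self])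
  have c1 : cupFun β (f' - f) g' = cupFun β f' g' - cupFun β f g' := by
    funext x; simp [cupFun]
  have c2 : cupFun β f (g' - g) = cupFun β f g' - cupFun β f g := by
    funext x; simp [cupFun]
  simp only [c1] at d1
  simp only [c2] at d2
  rw [cls_sub _ _ (coboundary_cupFun_eq_zero β hβ hf' hg')
    (coboundary_cupFun_eq_zero β hβ hf hg'), sub_eq_zero] at d1
  rw [cls_sub _ _ (coboundary_cupFun_eq_zero β hβ hf hg')
    (coboundary_cupFun_eq_zero β hβ hf hg), sub_eq_zero] at d2
  exact d1.trans d2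

/-- The cup product is computed by arbitrary representatives. -/
theorem cup_cls (β : A →ₗ[R] B →ₗ[R] C)
    (hβ : ∀ g a b, β (A.ρ g a) (B.ρ g b) = C.ρ g (β a b)) {p q : ℕ}
    (f : (Fin p → G) → A) (g : (Fin q → G) → B) (hf : coboundary A p f = 0)
    (hg : coboundary B q g = 0) :
    cup β hβ (cls f hf) (cls g hg) =
      cls (cupFun β f g) (coboundary_cupFun_eq_zero β hβ hf hg) :=
  cls_cupFun_congr β hβ f _ g _ hf _ hg _ (exists_represents (cls f hf)).choose_spec.choose_spec
    (exists_represents (cls g hg)).choose_spec.choose_spec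

end Cohomology
/-! ## The free group, its first homology and the tensor powers -/

section FreeGroup

variable (R ι : Type u) [CommRing R]

/-- `F`, the free group on the basis `ι`. -/
abbrev F : Type u := FreeGroup ι

/-- `Aut(F)`; the product is composition. -/
abbrev AutF : Type u := MulAut (FreeGroup ι)

/-- The semidirect product `F ⋊ Aut(F)`, with `(γ₁, φ₁)(γ₂, φ₂) = (γ₁ φ₁(γ₂), φ₁ φ₂)`. -/
abbrev AutFBar : Type u := FreeGroup ι ⋊[MonoidHom.id (MulAut (FreeGroup ι))] MulAut (FreeGroup ι)

/-- `H = H₁(F; R) = F^ab ⊗ R`. -/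
def H : Type u := R ⊗[ℤ] Additive (Abelianization (FreeGroup ι))

instance : AddCommGroup (H R ι) :=
  inferInstanceAs (AddCommGroup (R ⊗[ℤ] Additive (Abelianization (FreeGroup ι))))

instance : Module R (H R ι) :=
  inferInstanceAs (Module R (R ⊗[ℤ] Additive (Abelianization (FreeGroup ι))))

/-- `H^{⊗m}`. -/
def HPow (m : ℕ) : Type u := ⨂[R]^m (H R ι)

instance (m : ℕ) : AddCommGroup (HPow R ι m) := inferInstanceAs (AddCommGroup (⨂[R]^m (H R ι)))

instance (m : ℕ) : Module R (HPow R ι m) := inferInstanceAs (Module R (⨂[R]^m (H R ι)))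

variable {ι}

/-- The pure tensor `a₁ ⊗ ⋯ ⊗ a_m`. -/
def pureTensor {m : ℕ} (a : Fin m → H R ι) : HPow R ι m :=
  PiTensorProduct.tprod R (s := fun _ : Fin m => H R ι) a

variable {R} in
theorem HPow.induction {m : ℕ} {P : HPow R ι m → Prop}
    (h1 : ∀ (r : R) (a : Fin m → H R ι), P (r • pureTensor R a))
    (h2 : ∀ x y, P x → P y → P (x + y)) (x : HPow R ι m) : P x :=
  PiTensorProduct.induction_on (R := R) (s := fun _ : Fin m => H R ι) x h1 h2

/-- The homology class `[γ] ∈ H` of `γ ∈ F`. -/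
def homologyClass (γ : F ι) : H R ι := 1 ⊗ₜ[ℤ] Additive.ofMul (Abelianization.of γ)

variable (ι)

theorem homologyClass_mul (γ δ : F ι) :
    homologyClass R (γ * δ) = homologyClass R γ + homologyClass R δ := by
  unfold homologyClass
  rw [map_mul, ofMul_mul]
  exact TensorProduct.tmul_add _ _ _

/-- The map `|φ| : H → H` induced by `φ ∈ Aut(F)`, with `|φ|[γ] = [φ γ]`. -/
def actH (φ : AutF ι) : H R ι →ₗ[R] H R ι :=
  LinearMap.baseChange R
    (MonoidHom.toAdditive (Abelianization.map (φ : FreeGroup ι →* FreeGroup ι))).toIntLinearMap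

theorem actH_homologyClass (φ : AutF ι) (γ : F ι) :
    actH R ι φ (homologyClass R γ) = homologyClass R (φ γ) := by
  unfold actH homologyClass
  erw [LinearMap.baseChange_tmul]
  rfl

variable {R ι} in
/-- A linear map on `H` is determined by its values on the classes `[γ]`. -/
theorem H.hom_ext {V : Type*} [AddCommGroup V] [Module R V] {f g : H R ι →ₗ[R] V}
    (h : ∀ γ : F ι, f (homologyClass R γ) = g (homologyClass R γ)) : f = g := by
  refine TensorProduct.AlgebraTensorModule.curry_injective (LinearMap.ext_ring ?_)
  refine LinearMap.ext fun x => ?_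
  obtain ⟨γ, rfl⟩ := QuotientGroup.mk_surjective x.toMul
  exact h γ

/-- The action of `Aut(F)` on `H` as a representation. -/
def rhoH : Representation R (AutF ι) (H R ι) where
  toFun φ := actH R ι φ
  map_one' := H.hom_ext fun γ => actH_homologyClass R ι 1 γ
  map_mul' φ ψ := H.hom_ext fun γ => by
    rw [Module.End.mul_apply, actH_homologyClass, actH_homologyClass, actH_homologyClass]
    rfl

theorem rhoH_homologyClass (φ : AutF ι) (γ : F ι) :
    rhoH R ι φ (homologyClass R γ) = homologyClass R (φ γ) :=
  actH_homologyClass R ι φ γ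

/-- The map `|φ|^{⊗m}` on `H^{⊗m}`. -/
def actPow (m : ℕ) (φ : AutF ι) : HPow R ι m →ₗ[R] HPow R ι m :=
  PiTensorProduct.map (s := fun _ : Fin m => H R ι) (t := fun _ : Fin m => H R ι)
    fun _ => rhoH R ι φ

theorem actPow_pureTensor {m : ℕ} (φ : AutF ι) (a : Fin m → H R ι) :
    actPow R ι m φ (pureTensor R a) = pureTensor R fun i => rhoH R ι φ (a i) :=
  PiTensorProduct.map_tprod _ _

/-- The diagonal action of `Aut(F)` on `H^{⊗m}`. -/
def rhoPow (m : ℕ) : Representation R (AutF ι) (HPow R ι m) where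
  toFun φ := actPow R ι m φ
  map_one' := LinearMap.ext fun x => by
    induction x using HPow.induction with
    | h1 r a => simp [actPow_pureTensor]
    | h2 x y hx hy => rw [map_add, hx, hy, map_add]
  map_mul' φ ψ := LinearMap.ext fun x => by
    induction x using HPow.induction with
    | h1 r a => simp [actPow_pureTensor]
    | h2 x y hx hy => rw [map_add, hx, hy, map_add]

theorem rhoPow_pureTensor {m : ℕ} (φ : AutF ι) (a : Fin m → H R ι) :
    rhoPow R ι m φ (pureTensor R a) = pureTensor R fun i => rhoH R ι φ (a i) :=
  actPow_pureTensor R ι φ a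

/-- The `Aut(F)`-module `H^* ⊗ V = Hom(H, V)`, for an `Aut(F)`-module `V`; the action is
`φ · u = φ ∘ u ∘ |φ|⁻¹`. -/
abbrev homH {V : Type u} [AddCommGroup V] [Module R V] (σ : Representation R (AutF ι) V) :
    Rep.{u} R (AutF ι) :=
  Rep.of ((rhoH R ι).linHom σ)

/-- The `Aut(F)`-module `H^* ⊗ H^{⊗m} = Hom(H, H^{⊗m})`. -/
abbrev homPow (m : ℕ) : Rep.{u} R (AutF ι) := homH R ι (rhoPow R ι m)

/-- An `Aut(F)`-module `V` as a module over `F ⋊ Aut(F)` by means of the projection. -/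
abbrev pullback {V : Type u} [AddCommGroup V] [Module R V] (σ : Representation R (AutF ι) V) :
    Rep.{u} R (AutFBar ι) :=
  Rep.of (σ.comp SemidirectProduct.rightHom)

/-- The isomorphism `H ≅ H^{⊗1}`. -/
def toPowOne : H R ι ≃ₗ[R] HPow R ι 1 :=
  (PiTensorProduct.subsingletonEquiv (R := R) (s := fun _ : Fin 1 => H R ι) 0).symm

theorem toPowOne_apply (x : H R ι) : toPowOne R ι x = pureTensor R fun _ => x :=
  PiTensorProduct.subsingletonEquiv_symm_apply' (0 : Fin 1) x

/-- The isomorphism `H^{⊗a} ⊗ H^{⊗b} ≅ H^{⊗c}` (juxtaposition) for `a + b = c`. -/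
def mulPow {a b c : ℕ} (h : a + b = c) : HPow R ι a ⊗[R] HPow R ι b ≃ₗ[R] HPow R ι c :=
  (TensorPower.mulEquiv (R := R) (M := H R ι) (n := a) (m := b)).trans
    (TensorPower.cast R (H R ι) h)

theorem mulPow_pureTensor {a b c : ℕ} (h : a + b = c) (x : Fin a → H R ι) (y : Fin b → H R ι) :
    mulPow R ι h (pureTensor R x ⊗ₜ pureTensor R y) =
      pureTensor R (Fin.append x y ∘ Fin.cast h.symm) :=
  (congrArg (TensorPower.cast R (H R ι) h) (TensorPower.tprod_mul_tprod R x y)).trans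
    (TensorPower.cast_tprod R (H R ι) h _)

theorem rhoPow_toPowOne (φ : AutF ι) (x : H R ι) :
    rhoPow R ι 1 φ (toPowOne R ι x) = toPowOne R ι (rhoH R ι φ x) := by
  rw [toPowOne_apply, toPowOne_apply, rhoPow_pureTensor]

theorem rhoPow_mulPow {a b c : ℕ} (h : a + b = c) (φ : AutF ι) (x : HPow R ι a)
    (y : HPow R ι b) :
    rhoPow R ι c φ (mulPow R ι h (x ⊗ₜ y)) =
      mulPow R ι h (rhoPow R ι a φ x ⊗ₜ rhoPow R ι b φ y) := by
  induction x using HPow.induction with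
  | h2 x x' hx hx' => simp only [TensorProduct.add_tmul, map_add, hx, hx']
  | h1 r x =>
    induction y using HPow.induction with
    | h2 y y' hy hy' => simp only [TensorProduct.tmul_add, map_add, hy, hy']
    | h1 s y =>
      have key : rhoPow R ι c φ (mulPow R ι h (pureTensor R x ⊗ₜ pureTensor R y)) =
          mulPow R ι h (rhoPow R ι a φ (pureTensor R x) ⊗ₜ rhoPow R ι b φ (pureTensor R y)) := by
        rw [rhoPow_pureTensor, rhoPow_pureTensor, mulPow_pureTensor, mulPow_pureTensor,
          rhoPow_pureTensor]
        congr 1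
        subst h
        funext i
        refine Fin.addCases (fun i => ?_) (fun i => ?_) i <;> simp
      simp only [← TensorProduct.smul_tmul', TensorProduct.tmul_smul, map_smul, key]

/-! ## The powers of `k₀` -/

/-- The cochain `k₀(γφ) = [γ]` on `F ⋊ Aut(F)`. -/
def k0Fun (x : Fin 1 → AutFBar ι) : pullback R ι (rhoPow R ι 1) :=
  toPowOne R ι (homologyClass R (x 0).left)

theorem coboundary_k0Fun : coboundary (pullback R ι (rhoPow R ι 1)) 1 (k0Fun R ι) = 0 := by
  funext x
  rw [coboundary_apply]
  have e : homologyClass R (x 0 * x 1).left =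
      homologyClass R (x 0).left + rhoH R ι (x 0).right (homologyClass R (x 1).left) := by
    rw [rhoH_homologyClass, SemidirectProduct.mul_left]
    exact homologyClass_mul R ι _ _
  have e1 : (pullback R ι (rhoPow R ι 1)).ρ (x 0) (toPowOne R ι (homologyClass R (x 1).left)) =
      toPowOne R ι (rhoH R ι (x 0).right (homologyClass R (x 1).left)) :=
    rhoPow_toPowOne R ι _ _
  have c0 : Fin.contractNth (0 : Fin 2) (· * ·) x 0 = x 0 * x 1 := by
    simp [Fin.contractNth]
  have c1 : Fin.contractNth (1 : Fin 2) (· * ·) x 0 = x 0 := by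
    simp [Fin.contractNth]
  have c2 : ∀ f : Fin (1 + 1) → HPow R ι 1, ∑ j, f j = f 0 + f 1 := Fin.sum_univ_two
  refine (congrArg₂ (· + ·) e1 (c2 _)).trans ?_
  simp only [k0Fun, c0, c1, e, map_add]
  simp


/-- The class `k₀ ∈ H¹(F ⋊ Aut(F); H)`. -/
def k0 : groupCohomology (pullback R ι (rhoPow R ι 1)) 1 :=
  cls (k0Fun R ι) (coboundary_k0Fun R ι)

/-- `k₀^{⊗(p+1)} ∈ H^{p+1}(F ⋊ Aut(F); H^{⊗(p+1)})`. -/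
def k0Pow : (p : ℕ) → groupCohomology (pullback R ι (rhoPow R ι (p + 1))) (p + 1)
  | 0 => k0 R ι
  | p + 1 => cup (A := pullback R ι (rhoPow R ι (p + 1))) (B := pullback R ι (rhoPow R ι 1))
      (C := pullback R ι (rhoPow R ι (p + 1 + 1)))
      ((TensorProduct.mk R _ _).compr₂ (mulPow R ι rfl).toLinearMap)
      (fun g a b => (rhoPow_mulPow R ι rfl g.right a b).symm) (k0Pow p) (k0 R ι)

/-! ## The Gysin map -/

section Gysin

variable {ι} {V : Type u} [AddCommGroup V]

/-- A cochain is normalized if it vanishes as soon as one of its arguments is `1`. -/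
def IsNormalized {G : Type u} [Group G] {m : ℕ} (f : (Fin m → G) → V) : Prop :=
  ∀ g, (∃ i, g i = 1) → f g = 0

/-- Membership in the `p`-th step of the Hochschild–Serre filtration on `(p+1)`-cochains of
`F ⋊ Aut(F)`: `f` vanishes as soon as two of its `p + 1` arguments lie in the normal subgroup
`F`. -/
def InFiltration {p : ℕ} (f : (Fin (p + 1) → AutFBar ι) → V) : Prop :=
  ∀ g, (∃ i j, i ≠ j ∧ (g i).right = 1 ∧ (g j).right = 1) → f g = 0

/-- The sum over all shuffles of one argument `γ ∈ F` into `φ₁,…,φ_p ∈ Aut(F)`: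
`f₁(γ, φ₁,…,φ_p) = ∑ᵢ (-1)ⁱ f(φ₁,…,φᵢ, (φ₁⋯φᵢ)⁻¹(γ), φᵢ₊₁,…,φ_p)`. -/
def shuffle {p : ℕ} (f : (Fin (p + 1) → AutFBar ι) → V) (γ : F ι) (φ : Fin p → AutF ι) : V :=
  ∑ i : Fin (p + 1), (-1 : ℤ) ^ (i : ℕ) •
    f (i.insertNth (SemidirectProduct.inl
        ((((List.ofFn φ).take i).prod)⁻¹ γ)) fun j => SemidirectProduct.inr (φ j))

variable {R} [Module R V] (σ : Representation R (AutF ι) V)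

/-- The relation `d = π_♯ c`, for the Gysin map
`π_♯ : H^{p+1}(F ⋊ Aut(F); V) → H^p(Aut(F); H¹(F; V)) = H^p(Aut(F); Hom(H, V))` of the extension
`F → F ⋊ Aut(F) → Aut(F)`, i.e. the edge map of its Hochschild–Serre spectral sequence: `c` has a
normalized representative `f` in the `p`-th step of the Hochschild–Serre filtration and `d` has a
representative `v` such that `v(φ₁,…,φ_p)[γ] = f₁(γ, φ₁,…,φ_p)`. -/
def IsGysinImage {p : ℕ} (c : groupCohomology (pullback R ι σ) (p + 1))
    (d : groupCohomology (homH R ι σ) p) : Prop :=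
  ∃ (f : (Fin (p + 1) → AutFBar ι) → V) (v : (Fin p → AutF ι) → (H R ι →ₗ[R] V)),
    Represents (A := pullback R ι σ) f c ∧ IsNormalized f ∧ InFiltration f ∧
    Represents (A := homH R ι σ) v d ∧
    ∀ φ γ, v φ (homologyClass R γ) = shuffle f γ φ

open Classical in
/-- The Gysin map `π_♯`, as the function whose graph is `IsGysinImage`. (Every class has a unique
Gysin image, because `Hⁱ(F; V) = 0` for `i ≥ 2`.) -/
def gysin {p : ℕ} (c : groupCohomology (pullback R ι σ) (p + 1)) :
    groupCohomology (homH R ι σ) p :=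
  if h : ∃! d, IsGysinImage σ c d then h.choose else 0

end Gysin

/-- The class `h_p = π_♯(k₀^{⊗(p+1)}) ∈ H^p(Aut(F); H^* ⊗ H^{⊗(p+1)})`. -/
def hClass (p : ℕ) : groupCohomology (homPow R ι (p + 1)) p :=
  gysin (rhoPow R ι (p + 1)) (k0Pow R ι p)

/-! ## Parenthesizations -/

/-- `u ⊗ v : H^{⊗2} → H^{⊗c}` for `u : H → H^{⊗a}`, `v : H → H^{⊗b}` and `a + b = c`. -/
def tensorHom {a b c : ℕ} (h : a + b = c) (u : H R ι →ₗ[R] HPow R ι a)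
    (v : H R ι →ₗ[R] HPow R ι b) : HPow R ι 2 →ₗ[R] HPow R ι c :=
  (mulPow R ι h).toLinearMap ∘ₗ TensorProduct.map (u ∘ₗ (toPowOne R ι).symm.toLinearMap)
    (v ∘ₗ (toPowOne R ι).symm.toLinearMap) ∘ₗ
      (mulPow R ι (rfl : 1 + 1 = 2)).symm.toLinearMap

/-- The bilinear map `(u, v) ↦ u ⊗ v`. -/
def tensorHomBilin {a b c : ℕ} (h : a + b = c) :
    (H R ι →ₗ[R] HPow R ι a) →ₗ[R] (H R ι →ₗ[R] HPow R ι b) →ₗ[R]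
      (HPow R ι 2 →ₗ[R] HPow R ι c) :=
  LinearMap.mk₂ R (tensorHom R ι h)
    (by intros; simp only [tensorHom, LinearMap.add_comp, LinearMap.comp_add,
          TensorProduct.map_add_left])
    (by intros; simp only [tensorHom, LinearMap.smul_comp, LinearMap.comp_smul,
          TensorProduct.map_smul_left])
    (by intros; simp only [tensorHom, LinearMap.add_comp, LinearMap.comp_add,
          TensorProduct.map_add_right])
    (by intros; simp only [tensorHom, LinearMap.smul_comp, LinearMap.comp_smul,
          TensorProduct.map_smul_right])

theorem tensorHomBilin_apply {a b c : ℕ} (h : a + b = c) (u : H R ι →ₗ[R] HPow R ι a)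
    (v : H R ι →ₗ[R] HPow R ι b) (x y : H R ι) :
    tensorHomBilin R ι h u v
      (mulPow R ι (rfl : 1 + 1 = 2) (toPowOne R ι x ⊗ₜ toPowOne R ι y)) =
      mulPow R ι h (u x ⊗ₜ v y) := by
  change tensorHom R ι h u v _ = _
  simp [tensorHom]

/-- The `Aut(F)`-module `Hom(H^{⊗2}, H^{⊗m})`. -/
abbrev homPow₂ (m : ℕ) : Rep.{u} R (AutF ι) := Rep.of ((rhoPow R ι 2).linHom (rhoPow R ι m))

theorem tensorHomBilin_equivariant {a b c : ℕ} (h : a + b = c) (φ : AutF ι)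
    (u : H R ι →ₗ[R] HPow R ι a) (v : H R ι →ₗ[R] HPow R ι b) :
    tensorHomBilin R ι h ((homPow R ι a).ρ φ u) ((homPow R ι b).ρ φ v) =
      (homPow₂ R ι c).ρ φ (tensorHomBilin R ι h u v) := by
  refine LinearMap.ext fun z => ?_
  obtain ⟨z, rfl⟩ := (mulPow R ι (rfl : 1 + 1 = 2)).surjective z
  induction z using TensorProduct.induction_on with
  | zero => simp only [map_zero]
  | add z z' hz hz' => simp only [map_add, hz, hz']
  | tmul x y =>
    obtain ⟨x, rfl⟩ := (toPowOne R ι).surjective x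
    obtain ⟨y, rfl⟩ := (toPowOne R ι).surjective y
    simp [tensorHomBilin_apply, Representation.linHom_apply, rhoPow_mulPow, rhoPow_toPowOne]

/-- Composition `(s, t) ↦ s ∘ t` of `t : H → H^{⊗2}` and `s : H^{⊗2} → H^{⊗m}`. -/
def compBilin (m : ℕ) : (HPow R ι 2 →ₗ[R] HPow R ι m) →ₗ[R] (H R ι →ₗ[R] HPow R ι 2) →ₗ[R]
    (H R ι →ₗ[R] HPow R ι m) :=
  LinearMap.llcomp R _ _ _

theorem compBilin_equivariant (m : ℕ) (φ : AutF ι) (s : HPow R ι 2 →ₗ[R] HPow R ι m)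
    (t : H R ι →ₗ[R] HPow R ι 2) :
    compBilin R ι m ((homPow₂ R ι m).ρ φ s) ((homPow R ι 2).ρ φ t) =
      (homPow R ι m).ρ φ (compBilin R ι m s t) := by
  refine LinearMap.ext fun x => ?_
  simp [compBilin, Representation.linHom_apply]

/-- The class `(x ⊗ y) ∘ h₁`, the coefficients of `x ∪ y ∪ h₁` being contracted by
`(u, v, t) ↦ (u ⊗ v) ∘ t`. -/
def graft {q r : ℕ} (x : groupCohomology (homPow R ι (q + 1)) q)
    (y : groupCohomology (homPow R ι (r + 1)) r) :
    groupCohomology (homPow R ι (q + r + 1 + 1)) (q + r + 1) :=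
  cup (A := homPow₂ R ι (q + r + 1 + 1)) (B := homPow R ι 2) (C := homPow R ι (q + r + 1 + 1))
    (compBilin R ι _) (compBilin_equivariant R ι _)
    (cup (A := homPow R ι (q + 1)) (B := homPow R ι (r + 1)) (C := homPow₂ R ι (q + r + 1 + 1))
      (tensorHomBilin R ι (by omega)) (tensorHomBilin_equivariant R ι _) x y)
    (hClass R ι 1)

/-- The class `1_H ∈ H⁰(Aut(F); H^* ⊗ H)`. -/
def oneClass : groupCohomology (homPow R ι 1) 0 :=
  cls (A := homPow R ι 1) (fun _ => (toPowOne R ι).toLinearMap) (by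
    funext g
    rw [coboundary_apply]
    refine LinearMap.ext fun x => ?_
    simp [Representation.linHom_apply, rhoPow_toPowOne])

end FreeGroup

/-- The vertices `S⁰_p` of the Stasheff associahedron `K_{p+1}`: the full parenthesizations of a
word of `p + 1` letters. There is one for a single letter, and a parenthesization of a longer word
is a pair `(w₁, w₂)` of parenthesizations of two shorter words. -/
inductive Vertex : ℕ → Type
  | letter : Vertex 0
  | pair {q r : ℕ} (w₁ : Vertex q) (w₂ : Vertex r) : Vertex (q + r + 1)

/-- The sign: `sgn(1) = 1`, `sgn((w₁, w₂)) = (-1)^{|w₂|} sgn(w₁) sgn(w₂)`. -/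
def Vertex.sgn : {p : ℕ} → Vertex p → ℤ
  | _, .letter => 1
  | _, .pair (r := r) w₁ w₂ => (-1) ^ r * w₁.sgn * w₂.sgn

/-- The class `h(w) ∈ H^p(Aut(F); H^* ⊗ H^{⊗(p+1)})`: `h(1) = 1_H`, `h((w₁, w₂)) = (h(w₁) ⊗ h(w₂)) ∘ h₁`. -/
def Vertex.h (R ι : Type u) [CommRing R] :
    {p : ℕ} → Vertex p → groupCohomology (homPow R ι (p + 1)) p
  | _, .letter => oneClass R ι
  | _, .pair w₁ w₂ => graft R ι (w₁.h R ι) (w₂.h R ι)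

end KawazumiMagnus

end

noncomputable section

namespace KawazumiMagnus

open scoped TensorProduct

open SemidirectProduct (inl inr)

/-! ### Peeling off the first argument of inhomogeneous cochains. -/

section Cochains

variable {R G : Type u} [CommRing R] [Group G]

/-! The argument has three ingredients: the Gysin relation is single-valued, the powers of `k₀` can
be rewritten so that their Gysin image is visible, and changing the bracketing of a product of
classes costs a sign.

Single-valuedness (`exists_coboundary_eq_of_shuffle`, `IsGysinImage.unique`) is proved by dimension
shifting. A module `V` embeds in the functions on `Aut(F)` with values in `V`, which form a
coinduced module. Its cohomology over `F ⋊ Aut(F)` is that of the free group `F`, so it vanishes in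
degrees at least two (`exists_coboundary_eq_of_rightTranslation`). An explicit prism operator makes
a filtered cocycle exact in this larger module and is compatible with the sum over shuffles, so the
question passes to the quotient module in one degree less. In the lowest degree a primitive
restricts to a homomorphism on `F`, which settles the matter.

For the computation, let `T` be a normalized cocycle of `Aut(F)` with values in `Hom(H, V)`. Then `T
∪ k₀` is filtered, and its Gysin image is `(-1)^p [T]` (`isGysinImage_pairK0`). A Magnus expansion
`1 + [γ] + θ₂(γ) + θ₃(γ) + ⋯` of the free group is used up to degree three. Its part `θ₂` shows that
`k₀ ∪ k₀ = -τ₁ ∪ k₀` in cohomology, where `τ₁` is the first Johnson cocycle (`cls_k0Sq`). Hence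
`k₀^{⊗(p+1)} = T_p ∪ k₀` with `T₀ = 1_H` and `T_{p+1} = (T_p ⊗ 1) ∘ (-τ₁)`. This gives existence,
`h₁ = [τ₁]`, and the recursion `h_{p+1} = (h_p ⊗ 1_H) ∘ h₁`.

The sign comes from the part `θ₃`. The second Johnson map satisfies `dτ₂ = -(τ₁ ⊗ 1 + 1 ⊗ τ₁) ∘ τ₁`,
so `(x ⊗ ((y ⊗ 1) ∘ h₁)) ∘ h₁ = -(((x ⊗ y) ∘ h₁) ⊗ 1) ∘ h₁` (`graft_graft_one`). Moving the `r`
carets of `h_r` one by one to the left bracketing yields `(h_q ⊗ h_r) ∘ h₁ = (-1)^r h_{q+r+1}`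
(`graft_hClass`), and induction over the tree finishes. -/

theorem contractNth_zero_cons {n : ℕ} (a : G) (g : Fin (n + 1) → G) :
    Fin.contractNth 0 (· * ·) (Fin.cons a g : Fin (n + 2) → G) =
      (Fin.cons (a * g 0) (Fin.tail g) : Fin (n + 1) → G) := by
  funext k
  refine Fin.cases ?_ (fun k => ?_) k
  · rw [Fin.contractNth_apply_of_eq _ _ _ _ (by simp)]
    simp
  · rw [Fin.contractNth_apply_of_gt _ _ _ _ (by simp)]
    simp [Fin.tail]

theorem contractNth_succ_cons {n : ℕ} (j : Fin (n + 1)) (a : G) (g : Fin (n + 1) → G) :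
    Fin.contractNth j.succ (· * ·) (Fin.cons a g : Fin (n + 2) → G) =
      (Fin.cons a (Fin.contractNth j (· * ·) g) : Fin (n + 1) → G) := by
  funext k
  refine Fin.cases ?_ (fun k => ?_) k
  · rw [Fin.contractNth_apply_of_lt _ _ _ _ (by simp)]
    simp
  · rw [Fin.cons_succ]
    rcases lt_trichotomy (k : ℕ) j with h | h | h
    · rw [Fin.contractNth_apply_of_lt _ _ _ _ (by simpa using h),
        Fin.contractNth_apply_of_lt _ _ _ _ h, ← Fin.succ_castSucc, Fin.cons_succ]
    · rw [Fin.contractNth_apply_of_eq _ _ _ _ (by simpa using h),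
        Fin.contractNth_apply_of_eq _ _ _ _ h, ← Fin.succ_castSucc, Fin.cons_succ, Fin.cons_succ]
    · rw [Fin.contractNth_apply_of_gt _ _ _ _ (by simpa using h),
        Fin.contractNth_apply_of_gt _ _ _ _ h, Fin.cons_succ]

/-- The part `∑ⱼ (-1)^(j+1) f(…, gⱼ gⱼ₊₁, …) + (-1)^(n+1) f(g₀,…,gₙ₋₁)` of the coboundary, in which
the coefficients are not acted upon. -/
def faces {V : Type*} [AddCommGroup V] {n : ℕ} (f : (Fin n → G) → V) (g : Fin (n + 1) → G) : V :=
  ∑ j : Fin (n + 1), (-1 : ℤ) ^ ((j : ℕ) + 1) • f (Fin.contractNth j (· * ·) g)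

theorem neg_one_pow_zsmul {V : Type*} [AddCommGroup V] [Module R V] (k : ℕ) (v : V) :
    (-1 : R) ^ k • v = (-1 : ℤ) ^ k • v := by
  rcases neg_one_pow_eq_or ℤ k with h | h <;> rcases Nat.even_or_odd k with hk | hk <;>
    simp [hk.neg_one_pow]

theorem coboundary_eq_faces (A : Rep.{u} R G) {n : ℕ} (f : (Fin n → G) → A)
    (g : Fin (n + 1) → G) :
    coboundary A n f g = A.ρ (g 0) (f (Fin.tail g)) + faces f g := by
  rw [coboundary_apply]
  congr 1
  exact Finset.sum_congr rfl fun j _ => neg_one_pow_zsmul _ _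

theorem coboundary_cons (A : Rep.{u} R G) {n : ℕ} (f : (Fin n → G) → A) (a : G)
    (g : Fin n → G) :
    coboundary A n f (Fin.cons a g : Fin (n + 1) → G) =
      A.ρ a (f g) + faces f (Fin.cons a g : Fin (n + 1) → G) := by
  rw [coboundary_eq_faces, Fin.tail_cons, Fin.cons_zero]

section
variable {V : Type*} [AddCommGroup V]

/-- Only the face that merges the first two arguments touches `a`; every other face is a face of the
cochain with `a` frozen, its sign reversed by the index shift. -/
theorem faces_cons {n : ℕ} (f : (Fin (n + 1) → G) → V) (a : G) (g : Fin (n + 1) → G) :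
    faces f (Fin.cons a g : Fin (n + 2) → G) =
      -f (Fin.cons (a * g 0) (Fin.tail g) : Fin (n + 1) → G) -
        faces (fun t : Fin n → G => f (Fin.cons a t : Fin (n + 1) → G)) g := by
  rw [faces, Fin.sum_univ_succ, sub_eq_add_neg, faces, ← Finset.sum_neg_distrib]
  congr 1
  · rw [contractNth_zero_cons]
    simp
  · refine Finset.sum_congr rfl fun j _ => ?_
    rw [contractNth_succ_cons, Fin.val_succ, pow_succ _ ((j : ℕ) + 1)]
    simp

theorem faces_cons_cons {n : ℕ} (f : (Fin (n + 1) → G) → V) (a b : G) (g : Fin n → G) :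
    faces f (Fin.cons a (Fin.cons b g : Fin (n + 1) → G) : Fin (n + 2) → G) =
      -f (Fin.cons (a * b) g : Fin (n + 1) → G) -
        faces (fun t : Fin n → G => f (Fin.cons a t : Fin (n + 1) → G))
          (Fin.cons b g : Fin (n + 1) → G) := by
  rw [faces_cons, Fin.cons_zero, Fin.tail_cons]

theorem faces_zero (f : (Fin 0 → G) → V) (g : Fin 1 → G) : faces f g = -f Fin.elim0 := by
  have : (Fin.contractNth 0 (· * ·) g : Fin 0 → G) = Fin.elim0 := Subsingleton.elim _ _
  simp [faces, this]

theorem faces_map {V' : Type*} [AddCommGroup V'] (T : V →+ V') {n : ℕ} (f : (Fin n → G) → V)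
    (g : Fin (n + 1) → G) : faces (fun t => T (f t)) g = T (faces f g) := by
  simp [faces, map_sum, map_zsmul]

theorem faces_sub {n : ℕ} (f f' : (Fin n → G) → V) (g : Fin (n + 1) → G) :
    faces (fun t => f t - f' t) g = faces f g - faces f' g := by
  simp [faces, smul_sub, Finset.sum_sub_distrib]

theorem faces_comp_hom {G' : Type*} [Group G'] (θ : G →* G') {n : ℕ} (f : (Fin n → G') → V)
    (g : Fin (n + 1) → G) :
    faces (fun t => f fun i => θ (t i)) g = faces f fun i => θ (g i) := by
  refine Finset.sum_congr rfl fun j _ => ?_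
  refine congrArg (fun t => (-1 : ℤ) ^ ((j : ℕ) + 1) • f t) (funext fun k => ?_)
  rcases lt_trichotomy (k : ℕ) j with h | h | h
  · rw [Fin.contractNth_apply_of_lt _ _ _ _ h, Fin.contractNth_apply_of_lt _ _ _ _ h]
  · rw [Fin.contractNth_apply_of_eq _ _ _ _ h, Fin.contractNth_apply_of_eq _ _ _ _ h, map_mul]
  · rw [Fin.contractNth_apply_of_gt _ _ _ _ h, Fin.contractNth_apply_of_gt _ _ _ _ h]

end

/-- An equivariant map of coefficients commutes with the coboundary. -/
theorem coboundary_map {A B : Rep.{u} R G} (T : A →+ B)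
    (hT : ∀ g a, T (A.ρ g a) = B.ρ g (T a)) {n : ℕ} (f : (Fin n → G) → A)
    (g : Fin (n + 1) → G) :
    coboundary B n (fun t => T (f t)) g = T (coboundary A n f g) := by
  rw [coboundary_eq_faces, coboundary_eq_faces, faces_map, map_add, hT]

theorem coboundary_coboundary (A : Rep.{u} R G) {n : ℕ} (f : (Fin n → G) → A) :
    coboundary A (n + 1) (coboundary A n f) = 0 :=
  congrArg (fun t => t.hom f) (groupCohomology.inhomogeneousCochains.d_comp_d n A)

theorem coboundary_neg (A : Rep.{u} R G) (n : ℕ) (f : (Fin n → G) → A) :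
    coboundary A n (-f) = -coboundary A n f :=
  map_neg (inhomogeneousCochains.d A n).hom f

theorem coboundary_zero (A : Rep.{u} R G) (n : ℕ) : coboundary A n 0 = 0 :=
  map_zero (inhomogeneousCochains.d A n).hom

theorem cls_congr {A : Rep.{u} R G} {n : ℕ} {f f' : (Fin n → G) → A} (h : f = f')
    (hf : coboundary A n f = 0) (hf' : coboundary A n f' = 0) : cls f hf = cls f' hf' := by
  subst h; rfl

theorem cls_add {A : Rep.{u} R G} {n : ℕ} (f g : (Fin n → G) → A) (hf : coboundary A n f = 0)
    (hg : coboundary A n g = 0) (hfg : coboundary A n (f + g) = 0) :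
    cls (f + g) hfg = cls f hf + cls g hg := by
  rw [← sub_eq_iff_eq_add, ← cls_sub _ _ hfg hg (by rw [add_sub_cancel_right]; exact hf)]
  exact cls_congr (add_sub_cancel_right f g) _ _

theorem cls_neg {A : Rep.{u} R G} {n : ℕ} (f : (Fin n → G) → A) (hf : coboundary A n f = 0)
    (hf' : coboundary A n (-f) = 0) : cls (-f) hf' = -cls f hf := by
  rw [eq_neg_iff_add_eq_zero, ← cls_add _ _ hf' hf (by rw [neg_add_cancel]; exact coboundary_zero A n)]
  exact cls_of_eq_zero _ _ (neg_add_cancel f)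

/-- The inhomogeneous cochains with values in a module of functions `G → V` are acyclic. -/
theorem exists_coboundary_eq_of_functions {V : Type u} [AddCommGroup V] [Module R V]
    (σ : Representation R G (G → V)) (hσ : ∀ g w x, σ g w x = w (x * g)) {n : ℕ}
    (z : (Fin (n + 1) → G) → (G → V)) (hz : coboundary (Rep.of σ) (n + 1) z = 0) :
    coboundary (Rep.of σ) n (fun t x => z (Fin.cons x t : Fin (n + 1) → G) 1) = z := by
  funext t x
  rw [coboundary_eq_faces]
  -- The contracting homotopy turns the point of evaluation into a first argument: in the cocycle
  -- equation at `(x, t)`, evaluated at `1`, the leading term is `z t x`, and the others are minus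
  -- the coboundary of the primitive.
  have h := congrFun (congrFun hz (Fin.cons x t : Fin (n + 2) → G)) 1
  rw [coboundary_cons, faces_cons] at h
  have e := faces_map (Pi.evalAddMonoidHom (fun _ : G => V) 1)
    (fun s => z (Fin.cons x s : Fin (n + 1) → G)) t
  have e' := faces_map (Pi.evalAddMonoidHom (fun _ : G => V) x)
    (fun s x => z (Fin.cons x s : Fin (n + 1) → G) 1) t
  simp only [Pi.evalAddMonoidHom_apply] at e e'
  simp only [Pi.add_apply, Pi.sub_apply, Pi.neg_apply, hσ, ← e, Pi.zero_apply, one_mul] at h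
  simp only [Pi.add_apply, hσ, ← e']
  rw [← sub_eq_zero, ← neg_eq_zero]
  refine Eq.trans ?_ (h.trans rfl)
  abel

end Cochains

/-! ### Splitting extensions of a free group. -/

section FreeExtension

variable {ι M : Type*} [AddCommGroup M]

/-- The extension of the free group by `M` defined by a normalized `2`-cocycle splits, with
prescribed values of the splitting on the basis. -/
theorem exists_cochain_of_free (ρ : FreeGroup ι →* AddMonoid.End M)
    (c : FreeGroup ι → FreeGroup ι → M)
    (hc : ∀ x y z, ρ x (c y z) + c x (y * z) = c (x * y) z + c x y)
    (h1 : ∀ x, c 1 x = 0) (m : ι → M) :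
    ∃ b : FreeGroup ι → M, (∀ x y, b (x * y) = b x + ρ x (b y) + c x y) ∧
      ∀ i, b (FreeGroup.of i) = m i := by
  have hρ : ∀ x y k, ρ (x * y) k = ρ x (ρ y k) := fun x y k => by
    rw [map_mul]
    rfl
  -- The extension group, twisted by `ρ` and `c`. Associativity is `hc`, and `h1` makes `(0, 1)` a
  -- left unit; left axioms suffice for a group.
  let : Mul (M × FreeGroup ι) := ⟨fun p q => (p.1 + ρ p.2 q.1 + c p.2 q.2, p.2 * q.2)⟩
  let : One (M × FreeGroup ι) := ⟨(0, 1)⟩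
  let : Inv (M × FreeGroup ι) := ⟨fun p => (-(ρ p.2⁻¹ p.1 + c p.2⁻¹ p.2), p.2⁻¹)⟩
  have hmul : ∀ p q : M × FreeGroup ι,
      p * q = (p.1 + ρ p.2 q.1 + c p.2 q.2, p.2 * q.2) := fun _ _ => rfl
  let : Group (M × FreeGroup ι) := Group.ofLeftAxioms
    (by
      rintro ⟨m, x⟩ ⟨n, y⟩ ⟨k, z⟩
      simp only [hmul, Prod.mk.injEq, mul_assoc, and_true, map_add, hρ]
      have := hc x y z
      rw [← sub_eq_zero] at this ⊢
      rw [← neg_eq_zero, ← this]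
      abel)
    (by
      rintro ⟨m, x⟩
      change ((0 : M) + ρ 1 m + c 1 x, 1 * x) = (m, x)
      simp [h1])
    (by
      rintro ⟨m, x⟩
      change (-(ρ x⁻¹ m + c x⁻¹ x) + ρ x⁻¹ m + c x⁻¹ x, x⁻¹ * x) = ((0 : M), (1 : FreeGroup ι))
      rw [inv_mul_cancel, add_assoc, neg_add_cancel])
  let pr : M × FreeGroup ι →* FreeGroup ι :=
    { toFun := Prod.snd, map_one' := rfl, map_mul' := fun _ _ => rfl }
  -- Freeness provides a homomorphic section with arbitrary values over the basis; its `M`-component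
  -- is the required cochain.
  let s : FreeGroup ι →* M × FreeGroup ι := FreeGroup.lift fun i => (m i, FreeGroup.of i)
  have hs : pr.comp s = MonoidHom.id _ := by
    ext i
    simp [pr, s]
  have hs' : ∀ x, (s x).2 = x := fun x => DFunLike.congr_fun hs x
  refine ⟨fun x => (s x).1, fun x y => ?_, fun i => ?_⟩
  · change (s (x * y)).1 = _
    rw [map_mul, hmul, hs', hs']
  · simp [s]

end FreeExtension

/-! ### Vanishing of the cohomology of coinduced modules in degrees at least two. -/

section Acyclic

variable {R ι : Type u} [CommRing R] {V : Type u} [AddCommGroup V] [Module R V]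

variable (R V) in
/-- The action on functions by right translation of the argument. -/
def rightTranslation (G : Type*) [Group G] : Representation R G (G → V) where
  toFun g :=
    { toFun := fun w x => w (x * g)
      map_add' := fun _ _ => rfl
      map_smul' := fun _ _ => rfl }
  map_one' := by
    ext w x
    simp
  map_mul' g h := by
    ext w x
    simp [mul_assoc]

theorem rightTranslation_apply {G : Type*} [Group G] (g : G) (w : G → V) (x : G) :
    rightTranslation R V G g w x = w (x * g) := rfl

/-- The action of `F` on functions on `F ⋊ Aut(F)` by left translation. -/
def leftTranslation (γ : F ι) : (AutFBar ι → V) →+ (AutFBar ι → V) where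
  toFun w x := w (SemidirectProduct.inl γ⁻¹ * x)
  map_zero' := rfl
  map_add' _ _ := rfl

theorem leftTranslation_apply (γ : F ι) (w : AutFBar ι → V) (x : AutFBar ι) :
    leftTranslation γ w x = w (SemidirectProduct.inl γ⁻¹ * x) := rfl

/-- `Hⁿ(F ⋊ Aut(F); Map(Aut(F), V)) = Hⁿ(F; V)` vanishes for `n ≥ 2`. -/
theorem exists_coboundary_eq_of_rightTranslation {n : ℕ}
    (z : (Fin (n + 2) → AutFBar ι) → (AutF ι → V))
    (hz : coboundary (pullback R ι (rightTranslation R V (AutF ι))) (n + 2) z = 0) :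
    ∃ c : (Fin (n + 1) → AutFBar ι) → (AutF ι → V),
      coboundary (pullback R ι (rightTranslation R V (AutF ι))) (n + 1) c = z := by
  set W : Rep.{u} R (AutFBar ι) := pullback R ι (rightTranslation R V (AutF ι)) with hW
  set W' : Rep.{u} R (AutFBar ι) := Rep.of (rightTranslation R V (AutFBar ι)) with hW'
  let j : W →+ W' :=
    { toFun := fun w x => w x.right
      map_zero' := rfl
      map_add' := fun _ _ => rfl }
  -- `j` identifies `W` with the functions on `F ⋊ Aut(F)` invariant under left translation by `F`,
  -- inside the acyclic module `W'`. A primitive of `z'` exists in `W'`, and the task is to make it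
  -- invariant.
  have hj : ∀ g w, j (W.ρ g w) = W'.ρ g (j w) := fun g w => rfl
  have hjinj : Function.Injective j := fun w w' h => by
    funext a
    exact congrFun h (SemidirectProduct.inr a)
  have hL : ∀ γ g (w : W'), leftTranslation γ (W'.ρ g w) = W'.ρ g (leftTranslation γ w) :=
    fun γ g w => by
      funext x
      exact congrArg w (mul_assoc _ _ _)
  have hLmul : ∀ (γ δ : F ι) (w : AutFBar ι → V),
      leftTranslation (γ * δ) w = leftTranslation γ (leftTranslation δ w) := fun γ δ w => by
    funext x
    simp [leftTranslation_apply, mul_assoc]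
  have hLone : ∀ w : AutFBar ι → V, leftTranslation 1 w = w := fun w => by
    funext x
    simp [leftTranslation_apply]
  have hLd : ∀ γ {k : ℕ} (f : (Fin k → AutFBar ι) → W'),
      coboundary W' k (fun t => leftTranslation γ (f t)) =
        fun t => leftTranslation γ (coboundary W' k f t) := fun γ k f =>
    funext fun t => coboundary_map (A := W') (B := W') (leftTranslation γ) (hL γ) f t
  let z' : (Fin (n + 2) → AutFBar ι) → W' := fun t => j (z t)
  have hz' : coboundary W' (n + 2) z' = 0 := by
    funext t
    rw [coboundary_map j hj, hz]
    rfl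
  let y : (Fin (n + 1) → AutFBar ι) → W' := fun t x => z' (Fin.cons x t) 1
  have hy : coboundary W' (n + 1) y = z' :=
    exists_coboundary_eq_of_functions _ (fun _ _ _ => rfl) z' hz'
  have hinv : ∀ γ t, leftTranslation γ (z' t) = z' t := fun γ t => by
    funext x
    exact congrArg (z t) (by simp)
  -- The failure of invariance of `y` is a cocycle because `z'` is invariant, so it has a primitive
  -- one degree lower. This second descent is why the degree must be at least two.
  have hu : ∀ γ : F ι, ∃ u : (Fin n → AutFBar ι) → W',
      coboundary W' n u = fun t => leftTranslation γ (y t) - y t := fun γ => by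
    refine ⟨_, exists_coboundary_eq_of_functions _ (fun _ _ _ => rfl) _ ?_⟩
    refine (coboundary_sub W' (n + 1) (fun t => leftTranslation γ (y t)) y).trans ?_
    rw [hLd, hy, sub_eq_zero]
    funext t
    exact hinv γ t
  choose u₀ hu₀ using hu
  -- The chosen primitives need not be compatible for different `γ`. Only those on the basis are
  -- kept; with zero cocycle they extend to a crossed homomorphism on the free group, and `hdu'`
  -- checks that its values still bound the failure of invariance.
  obtain ⟨u, humul, hugen⟩ := exists_cochain_of_free (ι := ι)
    (M := (Fin n → AutFBar ι) → (AutFBar ι → V))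
    { toFun := fun γ =>
        { toFun := fun f t => leftTranslation γ (f t)
          map_zero' := rfl
          map_add' := fun _ _ => rfl }
      map_one' := by
        ext f t x
        exact congrFun (hLone _) x
      map_mul' := fun γ δ => by
        ext f t x
        exact congrFun (hLmul _ _ _) x }
    (fun _ _ => 0) (by simp) (by simp) (fun i => u₀ (FreeGroup.of i))
  replace humul : ∀ γ δ, u (γ * δ) = u γ + fun t => leftTranslation γ (u δ t) := fun γ δ =>
    (humul γ δ).trans (add_zero _)
  have hdu : ∀ γ δ, coboundary W' n (u (γ * δ)) =
      coboundary W' n (u γ) + fun t => leftTranslation γ (coboundary W' n (u δ) t) := fun γ δ => by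
    rw [humul, ← hLd]
    exact coboundary_add _ _ _ _
  have hdu1 : coboundary W' n (u 1) = 0 := by
    have h := hdu 1 1
    simp only [hLone, mul_one] at h
    exact left_eq_add.1 h
  have hdu' : ∀ γ, coboundary W' n (u γ) = fun t => leftTranslation γ (y t) - y t := by
    intro γ
    induction γ using FreeGroup.induction_on with
    | C1 =>
      rw [hdu1]
      funext t
      rw [hLone, sub_self]
      rfl
    | of i =>
      rw [← hu₀, ← hugen]
    | inv_of i ih =>
      have h := hdu (FreeGroup.of i)⁻¹ (FreeGroup.of i)
      rw [inv_mul_cancel, hdu1, ih] at h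
      funext t
      have h' := congrFun h t
      simp only [Pi.add_apply, map_sub, ← hLmul, inv_mul_cancel, hLone] at h'
      exact (eq_neg_of_add_eq_zero_left (h'.symm.trans rfl)).trans (neg_sub _ _)
    | mul γ δ hγ hδ =>
      rw [hdu, hγ, hδ]
      funext t
      simp only [Pi.add_apply, map_sub, hLmul]
      abel
  -- The crossed homomorphism is principal, since left translation makes `W'` coinduced over `F`:
  -- the explicit `e` takes the value of `u` at the `F`-component of the point. Subtracting its
  -- coboundary makes `y` invariant.
  let e : (Fin n → AutFBar ι) → W' := fun t x => -u x.left t x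
  have he : ∀ γ t, leftTranslation γ (e t) - e t = u γ t := fun γ t => by
    funext x
    have h := congrFun (congrFun (humul γ (γ⁻¹ * x.left)) t) x
    rw [mul_inv_cancel_left] at h
    change -u (SemidirectProduct.inl γ⁻¹ * x).left t (SemidirectProduct.inl γ⁻¹ * x) -
      -u x.left t x = u γ t x
    rw [h]
    change _ - -(u γ t x + u (γ⁻¹ * x.left) t (SemidirectProduct.inl γ⁻¹ * x)) = _
    simp
  let y' : (Fin (n + 1) → AutFBar ι) → W' := y - coboundary W' n e
  have hy' : ∀ γ t, leftTranslation γ (y' t) = y' t := fun γ t => by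
    have h := congrFun (hdu' γ) t
    have h2 : u γ = (fun t => leftTranslation γ (e t)) - e := funext fun t => (he γ t).symm
    rw [h2, coboundary_sub, hLd] at h
    change leftTranslation γ (y t - coboundary W' n e t) = y t - coboundary W' n e t
    rw [map_sub, sub_eq_sub_iff_sub_eq_sub]
    exact h.symm
  have hdy' : coboundary W' (n + 1) y' = z' := by
    rw [coboundary_sub, coboundary_coboundary, sub_zero, hy]
  refine ⟨fun t a => y' t (SemidirectProduct.inr a), ?_⟩
  have hjc : (fun t => j fun a => y' t (SemidirectProduct.inr a)) = y' := by
    funext t x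
    have h := congrFun (hy' x.left⁻¹ t) (SemidirectProduct.inr x.right)
    rw [leftTranslation_apply, inv_inv, SemidirectProduct.inl_left_mul_inr_right] at h
    exact h.symm
  funext t
  apply hjinj
  rw [← coboundary_map j hj, hjc, hdy']

end Acyclic

/-! ### The shuffle sum and the prism operator. -/

section GysinUniqueness

variable {R ι : Type u} [CommRing R] {V : Type u} [AddCommGroup V]

theorem shuffle_zero (f : (Fin 1 → AutFBar ι) → V) (γ : F ι) (φ : Fin 0 → AutF ι) :
    shuffle f γ φ = f fun _ => inl γ := by
  rw [shuffle, Fin.sum_univ_one]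
  have : (fun j => inr (φ j) : Fin 0 → AutFBar ι) = Fin.elim0 := Subsingleton.elim _ _
  simp only [Fin.val_zero, pow_zero, one_smul]
  congr 1
  funext i
  fin_cases i
  simp

/-- Either `γ` stays in front, or it has moved past `a`, becoming `a⁻¹ γ` and changing the sign; the
remaining moves are a shuffle into the shorter list. -/
theorem shuffle_cons {p : ℕ} (f : (Fin (p + 2) → AutFBar ι) → V) (γ : F ι) (a : AutF ι)
    (φ : Fin p → AutF ι) :
    shuffle f γ (Fin.cons a φ : Fin (p + 1) → AutF ι) =
      f (Fin.cons (inl γ) (Fin.cons (inr a) fun j => inr (φ j) : Fin (p + 1) → AutFBar ι)) -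
        shuffle (fun t : Fin (p + 1) → AutFBar ι => f (Fin.cons (inr a) t)) (a⁻¹ γ) φ := by
  have e : (fun j => inr ((Fin.cons a φ : Fin (p + 1) → AutF ι) j) : Fin (p + 1) → AutFBar ι) =
      Fin.cons (inr a) fun j => inr (φ j) := by
    funext j
    refine Fin.cases ?_ (fun j => ?_) j <;> simp
  rw [shuffle, Fin.sum_univ_succ, sub_eq_add_neg, shuffle, ← Finset.sum_neg_distrib, e]
  congr 1
  · simp
  · refine Finset.sum_congr rfl fun j _ => ?_
    rw [Fin.insertNth_succ_cons, Fin.val_succ, pow_succ]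
    simp [List.ofFn_succ]

theorem shuffle_sub {p : ℕ} (f f' : (Fin (p + 1) → AutFBar ι) → V) (γ : F ι)
    (φ : Fin p → AutF ι) :
    shuffle (fun t => f t - f' t) γ φ = shuffle f γ φ - shuffle f' γ φ := by
  simp [shuffle, smul_sub, Finset.sum_sub_distrib]

theorem shuffle_map {V' : Type u} [AddCommGroup V'] (T : V →+ V') {p : ℕ}
    (f : (Fin (p + 1) → AutFBar ι) → V) (γ : F ι) (φ : Fin p → AutF ι) :
    shuffle (fun t => T (f t)) γ φ = T (shuffle f γ φ) := by
  simp [shuffle, map_sum, map_zsmul]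

theorem shuffle_zero_fun {p : ℕ} (γ : F ι) (φ : Fin p → AutF ι) :
    shuffle (fun _ => (0 : V)) γ φ = 0 := by
  simp [shuffle]

/-- A primitive, with coefficients in the functions on `Aut(F)`, of a cocycle of `F ⋊ Aut(F)`
which vanishes as soon as two of its arguments lie in `F`. -/
def prism {n : ℕ} (f : (Fin (n + 2) → AutFBar ι) → V) (t : Fin (n + 1) → AutFBar ι)
    (a : AutF ι) : V :=
  f (Fin.cons (inr a) t) -
    f (Fin.cons (inl (a (t 0).left))
      (Fin.cons (inr (a * (t 0).right)) (Fin.tail t) : Fin (n + 1) → AutFBar ι))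

theorem isNormalized_prism {n : ℕ} {f : (Fin (n + 2) → AutFBar ι) → V} (hf : IsNormalized f) :
    IsNormalized (prism f) := by
  rintro t ⟨i, hi⟩
  funext a
  rw [prism, hf _ ⟨i.succ, by simpa using hi⟩, zero_sub]
  refine neg_eq_zero.2 (hf _ ?_)
  induction i using Fin.cases with
  | zero => exact ⟨0, by simp [hi]⟩
  | succ i => exact ⟨i.succ.succ, by simpa [Fin.tail] using hi⟩

theorem inFiltration_prism {n : ℕ} {f : (Fin (n + 2) → AutFBar ι) → V} (hf : InFiltration f) :
    InFiltration (prism f) := by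
  rintro t ⟨i, j, hij, hi, hj⟩
  funext a
  rw [prism, hf _ ⟨i.succ, j.succ, by simpa using hij, by simpa using hi, by simpa using hj⟩,
    zero_sub]
  refine neg_eq_zero.2 (hf _ ?_)
  induction i using Fin.cases with
  | zero =>
    induction j using Fin.cases with
    | zero => exact absurd rfl hij
    | succ j => exact ⟨0, j.succ.succ, by simp [Fin.ext_iff], by simp, by simpa [Fin.tail] using hj⟩
  | succ i => exact ⟨0, i.succ.succ, by simp [Fin.ext_iff], by simp, by simpa [Fin.tail] using hi⟩

/-- The correction term of the prism vanishes when the first argument has trivial `F`-component, so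
it contributes only where `γ` comes first. This is exactly the term by which the shuffle into `(a,
φ)` exceeds the shuffle with `a` frozen in front. -/
theorem shuffle_prism {n : ℕ} {f : (Fin (n + 2) → AutFBar ι) → V} (hf : IsNormalized f)
    (γ : F ι) (φ : Fin n → AutF ι) (a : AutF ι) :
    shuffle (prism f) γ φ a = -shuffle f (a γ) (Fin.cons a φ : Fin (n + 1) → AutF ι) := by
  have key : ∀ k : (Fin (n + 1) → AutFBar ι) → V, (∀ t, (t 0).left = 1 → k t = 0) →
      shuffle k γ φ = k (Fin.cons (inl γ) fun j => inr (φ j)) := by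
    intro k hk
    cases n with
    | zero =>
      rw [shuffle_zero]
      congr 1
      funext i
      fin_cases i
      rfl
    | succ n =>
      obtain ⟨b, ψ, rfl⟩ : ∃ b ψ, φ = Fin.cons b ψ := ⟨φ 0, Fin.tail φ, (Fin.cons_self_tail φ).symm⟩
      have h0 : (fun t : Fin (n + 1) → AutFBar ι => k (Fin.cons (inr b) t)) = fun _ => 0 :=
        funext fun t => hk _ (by simp)
      rw [shuffle_cons, h0, shuffle_zero_fun, sub_zero]
      congr 2
      funext j
      refine Fin.cases ?_ (fun j => ?_) j <;> simp
  refine (shuffle_map (Pi.evalAddMonoidHom (fun _ : AutF ι => V) a) (prism f) γ φ).symm.trans ?_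
  simp only [Pi.evalAddMonoidHom_apply, prism]
  have hk := key (fun t => f (Fin.cons (inl (a (t 0).left))
    (Fin.cons (inr (a * (t 0).right)) (Fin.tail t) : Fin (n + 1) → AutFBar ι)))
    fun t ht => hf _ ⟨0, by simp [ht]⟩
  rw [shuffle_sub, shuffle_cons, hk]
  simp

variable [Module R V]

/-- Inserting `a` in front is not enough: the action moves `a` to `a · g₁.right`, whereas the face
merging `a` with `g₁` also has an `F`-component. The correction term splits this component off. The
identity is an alternating sum of three cocycle equations, starting with `a`, with the split form of
`a g₁`, and with that of `a g₁ g₂`. Terms with two arguments in `F` disappear by the filtration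
hypothesis. -/
theorem coboundary_prism (σ : Representation R (AutF ι) V) {n : ℕ}
    {f : (Fin (n + 2) → AutFBar ι) → V} (hf : InFiltration f)
    (hd : coboundary (pullback R ι σ) (n + 2) f = 0) (t : Fin (n + 2) → AutFBar ι) :
    coboundary (pullback R ι (rightTranslation R V (AutF ι))) (n + 1) (prism f) t =
      fun a => σ a (f t) := by
  obtain ⟨g₁, t, rfl⟩ : ∃ g s, t = Fin.cons g s := ⟨t 0, Fin.tail t, (Fin.cons_self_tail t).symm⟩
  obtain ⟨g₂, s, rfl⟩ : ∃ g s, t = Fin.cons g s := ⟨t 0, Fin.tail t, (Fin.cons_self_tail t).symm⟩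
  funext a
  have hcons : ∀ x y, σ x.right (f y) + faces f (Fin.cons x y : Fin (n + 3) → AutFBar ι) = 0 :=
    fun x y => (coboundary_cons (pullback R ι σ) f x y).symm.trans (congrFun hd _)
  have h1 := hcons (inr a) (Fin.cons g₁ (Fin.cons g₂ s))
  have h2 := hcons (inl (a g₁.left)) (Fin.cons (inr (a * g₁.right)) (Fin.cons g₂ s))
  have h3 := hcons (inl (a g₁.left)) (Fin.cons (inl ((a * g₁.right) g₂.left))
    (Fin.cons (inr (a * g₁.right * g₂.right)) s))
  have hz : (fun s' : Fin n → AutFBar ι => f (Fin.cons (inl (a g₁.left))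
      (Fin.cons (inl ((a * g₁.right) g₂.left)) s' : Fin (n + 1) → AutFBar ι))) = fun _ => 0 :=
    funext fun s' => hf _ ⟨0, 1, by simp, by simp, rfl⟩
  have m1 : (inr a : AutFBar ι) * g₁ = inl (a g₁.left) * inr (a * g₁.right) := by
    ext <;> simp
  have m2 : (inr (a * g₁.right) : AutFBar ι) * g₂ =
      inl ((a * g₁.right) g₂.left) * inr (a * g₁.right * g₂.right) := by
    ext <;> simp
  have m3 : (inl (a (g₁ * g₂).left) : AutFBar ι) =
      inl (a g₁.left) * inl ((a * g₁.right) g₂.left) := by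
    ext <;> simp
  have z0 : faces (fun _ : Fin n → AutFBar ι => (0 : V))
      (Fin.cons (inr (a * g₁.right * g₂.right)) s : Fin (n + 1) → AutFBar ι) = 0 := by
    simp [faces]
  rw [faces_cons_cons, m1] at h1
  rw [faces_cons_cons, faces_cons_cons, m2] at h2
  rw [faces_cons_cons, faces_cons_cons, hz, z0] at h3
  simp only [SemidirectProduct.right_inl, SemidirectProduct.right_inr, map_one,
    Module.End.one_apply] at h1 h2 h3
  have hfa := faces_map (Pi.evalAddMonoidHom (fun _ : AutF ι => V) a) (prism f)
    (Fin.cons g₁ (Fin.cons g₂ s))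
  simp only [Pi.evalAddMonoidHom_apply] at hfa
  rw [coboundary_cons]
  change prism f (Fin.cons g₂ s) (a * g₁.right) + faces (prism f) _ a = _
  rw [← hfa]
  simp only [prism]
  have hk := faces_cons_cons (fun t : Fin (n + 1) → AutFBar ι => f (Fin.cons (inl (a (t 0).left))
    (Fin.cons (inr (a * (t 0).right)) (Fin.tail t) : Fin (n + 1) → AutFBar ι))) g₁ g₂ s
  simp only [Fin.cons_zero, Fin.tail_cons, m3, SemidirectProduct.mul_right, ← mul_assoc] at hk
  rw [faces_sub, hk]
  simp only [Fin.cons_zero, Fin.tail_cons]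
  rw [← sub_eq_zero, ← neg_eq_zero]
  refine Eq.trans ?_ ((congrArg₂ (· - ·) (congrArg₂ (· - ·) h1 h2) (congrArg Neg.neg h3)).trans
    (by simp : (0 : V) - 0 - -0 = 0))
  abel

end GysinUniqueness

/-! ### Uniqueness of the Gysin image by dimension shifting. -/

section GysinUniqueness

variable {R ι : Type u} [CommRing R] {V : Type u} [AddCommGroup V] [Module R V]

/-- An additive function on `F` factors through `H`. -/
theorem exists_linearMap_of_additive (b : F ι → V) (hb : ∀ γ δ, b (γ * δ) = b γ + b δ) :
    ∃ L : H R ι →ₗ[R] V, ∀ γ, L (homologyClass R γ) = b γ := by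
  let θ : F ι →* Multiplicative V :=
    { toFun := fun γ => Multiplicative.ofAdd (b γ)
      map_one' := by
        have := hb 1 1
        rw [mul_one] at this
        exact congrArg Multiplicative.ofAdd (left_eq_add.1 this)
      map_mul' := fun γ δ => congrArg Multiplicative.ofAdd (hb γ δ) }
  let l : Additive (Abelianization (F ι)) →+ V := MonoidHom.toAdditiveLeft (Abelianization.lift θ)
  let L : R ⊗[ℤ] Additive (Abelianization (F ι)) →ₗ[R] V :=
    TensorProduct.AlgebraTensorModule.lift
      ((LinearMap.ringLmapEquivSelf R R _).symm l.toIntLinearMap)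
  refine ⟨L, fun γ => ?_⟩
  change (1 : R) • l (Additive.ofMul (Abelianization.of γ)) = b γ
  rw [one_smul]
  rfl

theorem homH_apply (σ : Representation R (AutF ι) V) (φ : AutF ι) (u : H R ι →ₗ[R] V) (γ : F ι) :
    (homH R ι σ).ρ φ u (homologyClass R γ) = σ φ (u (homologyClass R (φ⁻¹ γ))) := by
  change σ φ (u (rhoH R ι φ⁻¹ _)) = _
  rw [rhoH_homologyClass]

theorem coboundary_homH_apply (σ : Representation R (AutF ι) V) {n : ℕ}
    (v : (Fin n → AutF ι) → (H R ι →ₗ[R] V)) (φ : Fin (n + 1) → AutF ι) (γ : F ι) :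
    (coboundary (homH R ι σ) n v φ : H R ι →ₗ[R] V) (homologyClass R γ) =
      σ (φ 0) (v (Fin.tail φ) (homologyClass R ((φ 0)⁻¹ γ))) +
        faces (fun ψ => v ψ (homologyClass R γ)) φ := by
  rw [coboundary_eq_faces, LinearMap.add_apply, homH_apply]
  congr 1
  exact (faces_map (LinearMap.evalAddMonoidHom (homologyClass R γ)) v φ).symm

theorem coboundary_homH_comp {V' : Type u} [AddCommGroup V'] [Module R V']
    (σ : Representation R (AutF ι) V) (σ' : Representation R (AutF ι) V') (L : V →ₗ[R] V')
    (hL : ∀ φ v, L (σ φ v) = σ' φ (L v)) {n : ℕ}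
    (v : (Fin n → AutF ι) → (H R ι →ₗ[R] V)) (φ : Fin (n + 1) → AutF ι) :
    coboundary (homH R ι σ') n (fun ψ => L ∘ₗ v ψ) φ =
      L ∘ₗ (coboundary (homH R ι σ) n v φ : H R ι →ₗ[R] V) := by
  refine H.hom_ext fun γ => ?_
  refine Eq.trans ?_ (congrArg L (coboundary_homH_apply σ v φ γ)).symm
  rw [coboundary_homH_apply, map_add, hL]
  congr 1
  exact faces_map L.toAddMonoidHom (fun ψ => v ψ (homologyClass R γ)) φ

theorem coboundary_pullback_comp {V' : Type u} [AddCommGroup V'] [Module R V']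
    (σ : Representation R (AutF ι) V) (σ' : Representation R (AutF ι) V') (L : V →ₗ[R] V')
    (hL : ∀ φ v, L (σ φ v) = σ' φ (L v)) {n : ℕ}
    (f : (Fin n → AutFBar ι) → V) (g : Fin (n + 1) → AutFBar ι) :
    coboundary (pullback R ι σ') n (fun t => L (f t)) g =
      L (coboundary (pullback R ι σ) n f g) :=
  coboundary_map (A := pullback R ι σ) (B := pullback R ι σ') L.toAddMonoidHom
    (fun g v => hL g.right v) f g

/-- The embedding of an `Aut(F)`-module in the functions on `Aut(F)`. -/
def orbitMap (σ : Representation R (AutF ι) V) : V →ₗ[R] (AutF ι → V) :=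
  LinearMap.pi fun a => σ a

theorem orbitMap_apply (σ : Representation R (AutF ι) V) (v : V) (a : AutF ι) :
    orbitMap σ v a = σ a v := rfl

theorem orbitMap_equivariant (σ : Representation R (AutF ι) V) (φ : AutF ι) (v : V) :
    orbitMap σ (σ φ v) = rightTranslation R V (AutF ι) φ (orbitMap σ v) := by
  funext a
  rw [rightTranslation_apply, orbitMap_apply, orbitMap_apply, map_mul]
  rfl

/-- The primitive, with coefficients in functions on `Aut(F)`, of a cocycle of `Aut(F)`. -/
def cone {n : ℕ} (v : (Fin (n + 1) → AutF ι) → (H R ι →ₗ[R] V)) (φ : Fin n → AutF ι) :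
    H R ι →ₗ[R] (AutF ι → V) :=
  LinearMap.pi fun a => v (Fin.cons a φ) ∘ₗ rhoH R ι a

theorem cone_apply {n : ℕ} (v : (Fin (n + 1) → AutF ι) → (H R ι →ₗ[R] V)) (φ : Fin n → AutF ι)
    (γ : F ι) (a : AutF ι) :
    cone v φ (homologyClass R γ) a = v (Fin.cons a φ) (homologyClass R (a γ)) := by
  change v _ (rhoH R ι a _) = _
  rw [rhoH_homologyClass]

/-- The cocycle equation for `v` at `(a, φ)`, applied to the class of `a γ`: the leading term `a ·
v(φ)` becomes the value at `a` of the orbit map. Precomposition with `|a|` in `cone` undoes the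
contragredient action on `H`. -/
theorem coboundary_cone (σ : Representation R (AutF ι) V) {n : ℕ}
    (v : (Fin (n + 1) → AutF ι) → (H R ι →ₗ[R] V))
    (hv : coboundary (homH R ι σ) (n + 1) v = 0) (φ : Fin (n + 1) → AutF ι) :
    coboundary (homH R ι (rightTranslation R V (AutF ι))) n (cone v) φ = orbitMap σ ∘ₗ v φ := by
  refine H.hom_ext fun γ => ?_
  rw [coboundary_homH_apply]
  funext a
  have h := coboundary_homH_apply σ v (Fin.cons a φ) (a γ)
  rw [hv] at h
  have hfa := faces_map (Pi.evalAddMonoidHom (fun _ : AutF ι => V) a)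
    (fun ψ => cone v ψ (homologyClass R γ)) φ
  simp only [Pi.evalAddMonoidHom_apply, cone_apply] at hfa
  rw [Pi.add_apply, ← hfa, rightTranslation_apply, cone_apply, LinearMap.comp_apply,
    orbitMap_apply]
  rw [faces_cons, Fin.cons_zero, Fin.tail_cons] at h
  replace h : (0 : V) = _ := h
  simp only [MulAut.mul_apply, MulAut.inv_apply_self, MulAut.apply_inv_self] at h ⊢
  rw [← sub_eq_zero, ← neg_eq_zero]
  refine Eq.trans ?_ h.symm
  abel

/-- The Gysin image of a coboundary is a coboundary. -/
theorem exists_coboundary_eq_of_shuffle (m : ℕ) : ∀ {V : Type u} [AddCommGroup V] [Module R V]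
    (σ : Representation R (AutF ι) V) (b : (Fin (m + 1) → AutFBar ι) → V)
    (f : (Fin (m + 2) → AutFBar ι) → V) (v : (Fin (m + 1) → AutF ι) → (H R ι →ₗ[R] V)),
    coboundary (pullback R ι σ) (m + 1) b = f → IsNormalized f → InFiltration f →
    coboundary (homH R ι σ) (m + 1) v = 0 →
    (∀ φ γ, v φ (homologyClass R γ) = shuffle f γ φ) →
    ∃ β : (Fin m → AutF ι) → (H R ι →ₗ[R] V), coboundary (homH R ι σ) m β = v := by
  induction m with
  | zero =>
    intro V _ _ σ b f v hbf hn hf hv hs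
    have hb : ∀ x y, f (Fin.cons x (Fin.cons y Fin.elim0)) =
        σ x.right (b (Fin.cons y Fin.elim0)) - b (Fin.cons (x * y) Fin.elim0) +
          b (Fin.cons x Fin.elim0) := fun x y => by
      rw [← hbf, coboundary_cons, faces_cons, faces_zero, sub_neg_eq_add, Fin.cons_zero, Fin.tail_cons,
        ← add_assoc, ← sub_eq_add_neg]
      rfl
    -- The filtration hypothesis makes `f` vanish on pairs from `F`, and `F` acts trivially on `V`,
    -- so the primitive `b` is additive on `F`.
    obtain ⟨L, hL⟩ := exists_linearMap_of_additive (R := R)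
      (fun γ : F ι => b (Fin.cons (inl γ) Fin.elim0)) fun γ δ => by
        have h := hb (inl γ) (inl δ)
        rw [hf _ ⟨0, 1, by simp, rfl, rfl⟩, ← map_mul] at h
        simp only [SemidirectProduct.right_inl, map_one, Module.End.one_apply] at h
        rw [← sub_eq_zero, ← neg_eq_zero, h]
        abel
    -- In `f(γ, a) - f(a, a⁻¹γ)` the values of `b` at `a` cancel, and so do those at the products,
    -- because `γ a = a (a⁻¹ γ)`. What remains is `L[γ] - a L[a⁻¹γ]`, the coboundary of `-L`.
    refine ⟨fun _ => -L, ?_⟩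
    funext φ
    obtain ⟨a, ψ, rfl⟩ : ∃ b ψ, φ = Fin.cons b ψ := ⟨φ 0, Fin.tail φ, (Fin.cons_self_tail φ).symm⟩
    refine H.hom_ext fun γ => ?_
    rw [coboundary_homH_apply, faces_zero, hs, shuffle_cons, shuffle_zero, Fin.cons_zero,
      LinearMap.neg_apply, LinearMap.neg_apply, hL, hL, map_neg]
    have e1 : (fun j => inr (ψ j) : Fin 0 → AutFBar ι) = Fin.elim0 := Subsingleton.elim _ _
    have e2 : (fun _ => inl (a⁻¹ γ) : Fin 1 → AutFBar ι) = Fin.cons (inl (a⁻¹ γ)) Fin.elim0 := by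
      funext i
      fin_cases i
      rfl
    have e3 : (inr a * inl (a⁻¹ γ) : AutFBar ι) = inl γ * inr a := by
      ext <;> simp
    rw [e1, e2, hb, hb, e3]
    simp only [SemidirectProduct.right_inl, SemidirectProduct.right_inr, map_one,
      Module.End.one_apply]
    abel
  | succ m ih =>
    intro V _ _ σ b f v hbf hn hf hv hs
    set τ := rightTranslation R V (AutF ι)
    set i := orbitMap σ
    have hi : ∀ φ x, i (σ φ x) = τ φ (i x) := orbitMap_equivariant σ
    have hfd : coboundary (pullback R ι σ) (m + 3) f = 0 := by
      rw [← hbf]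
      exact coboundary_coboundary _ _
    -- Both `prism f` and `i ∘ b` are primitives of `i ∘ f`, so their difference is a cocycle in the
    -- coinduced module, where it bounds.
    have hz : coboundary (pullback R ι τ) (m + 2) (prism f - fun t => i (b t)) = 0 := by
      rw [coboundary_sub, sub_eq_zero]
      funext t
      rw [coboundary_pullback_comp σ τ i hi, hbf]
      exact coboundary_prism σ hf hfd t
    obtain ⟨c, hc⟩ := exists_coboundary_eq_of_rightTranslation _ hz
    have hinv : ∀ φ, LinearMap.range i ≤ (LinearMap.range i).comap (τ φ) := by
      rintro φ _ ⟨x, rfl⟩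
      exact ⟨σ φ x, hi φ x⟩
    let Q := (AutF ι → V) ⧸ LinearMap.range i
    let π : (AutF ι → V) →ₗ[R] Q := (LinearMap.range i).mkQ
    let σQ : Representation R (AutF ι) Q := τ.quotient (LinearMap.range i) hinv
    have hπ : ∀ φ w, π (τ φ w) = σQ φ (π w) := fun φ w => rfl
    have hπi : ∀ x, π (i x) = 0 := fun x =>
      (Submodule.Quotient.mk_eq_zero _).2 ⟨x, rfl⟩
    let ev : (AutF ι → V) →ₗ[R] V := LinearMap.proj 1
    have hev : ∀ x, ev (i x) = x := fun x => by
      change σ 1 x = x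
      rw [map_one]
      rfl
    -- Evaluation at `1` is a linear retraction of `i`, hence `π` has a linear section. It need not
    -- be equivariant; it only lifts cochains.
    let s : Q →ₗ[R] (AutF ι → V) := (LinearMap.range i).liftQ (LinearMap.id - i ∘ₗ ev) (by
      rintro _ ⟨x, rfl⟩
      simp [hev])
    have hs' : ∀ q, π (s q) = q := by
      intro q
      obtain ⟨w, rfl⟩ := Submodule.Quotient.mk_surjective _ q
      change π (w - i (ev w)) = π w
      rw [map_sub, hπi, sub_zero]
    -- Modulo the image of `i` the term `i ∘ b` disappears, so `π ∘ c` bounds `π ∘ prism f`. The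
    -- induction hypothesis, which allows any coefficients, applies to `Q` one degree lower; the
    -- minus sign is that of `shuffle_prism`.
    obtain ⟨βQ, hβQ⟩ := ih σQ (fun t => π (c t)) (fun t => π (prism f t))
      (fun φ => π ∘ₗ (-cone v φ))
      (by
        funext t
        rw [coboundary_pullback_comp τ σQ π hπ, hc]
        exact (map_sub π _ _).trans (by rw [hπi, sub_zero]))
      (fun g hg => (congrArg π (isNormalized_prism hn g hg)).trans (map_zero π))
      (fun g hg => (congrArg π (inFiltration_prism hf g hg)).trans (map_zero π))
      (by
        funext φ
        rw [coboundary_homH_comp τ σQ π hπ]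
        have : coboundary (homH R ι τ) (m + 1) (fun φ => -cone v φ) φ = -(i ∘ₗ v φ) := by
          rw [← coboundary_cone σ v hv]
          exact congrFun (coboundary_neg (homH R ι τ) _ (cone v)) φ
        rw [this]
        refine LinearMap.ext fun x => ?_
        simp only [LinearMap.comp_apply, LinearMap.neg_apply, map_neg, hπi]
        exact neg_zero)
      (fun φ γ => by
        refine Eq.trans ?_ (shuffle_map π.toAddMonoidHom (prism f) γ φ).symm
        refine congrArg π ?_
        funext a
        rw [shuffle_prism hn, ← hs, LinearMap.neg_apply, Pi.neg_apply, cone_apply])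
    let β : (Fin m → AutF ι) → (H R ι →ₗ[R] (AutF ι → V)) := fun φ => s ∘ₗ βQ φ
    -- Adding the coboundary of the lift cancels `cone v` in `Q`, so `δ` takes values in the image
    -- of `i`. Since `δ` has the same coboundary as `cone v`, namely `i ∘ v`, the cochain `ev ∘ δ`
    -- is a primitive of `v`.
    let δ : (Fin (m + 1) → AutF ι) → (H R ι →ₗ[R] (AutF ι → V)) :=
      cone v + coboundary (homH R ι τ) m β
    have hδ : ∀ φ x, i (ev (δ φ x)) = δ φ x := by
      intro φ x
      have h1 : π (δ φ x) = 0 := by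
        have h2 := congrArg (fun u => u x) (congrFun hβQ φ)
        have h3 : (fun φ => π ∘ₗ β φ) = βQ := by
          funext φ
          exact LinearMap.ext fun x => hs' _
        rw [← h3, coboundary_homH_comp τ σQ π hπ] at h2
        replace h2 : π ((coboundary (homH R ι τ) m β φ : H R ι →ₗ[R] (AutF ι → V)) x) =
          π (-cone v φ x) := h2
        refine (map_add π (cone v φ x) _).trans ?_
        rw [h2, map_neg, add_neg_cancel]
      obtain ⟨y, hy⟩ := (Submodule.Quotient.mk_eq_zero _).1 h1
      rw [← hy, hev]
    refine ⟨fun φ => ev ∘ₗ δ φ, ?_⟩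
    funext φ
    have h1 : (fun φ => i ∘ₗ ev ∘ₗ δ φ) = δ := by
      funext φ
      exact LinearMap.ext fun x => hδ φ x
    have h2 := coboundary_homH_comp σ τ i hi (fun φ => ev ∘ₗ δ φ) φ
    rw [h1] at h2
    have h3 : coboundary (homH R ι τ) (m + 1) δ φ = i ∘ₗ v φ := by
      rw [← coboundary_cone σ v hv]
      have := coboundary_add (homH R ι τ) (m + 1) (cone v) (coboundary (homH R ι τ) m β)
      rw [coboundary_coboundary, add_zero] at this
      exact congrFun this φ
    rw [h3] at h2
    refine LinearMap.ext fun x => ?_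
    have h4 := congrArg (fun u => ev (u x)) h2
    simp only [LinearMap.comp_apply, hev] at h4
    exact h4.symm

/-- A class has at most one Gysin image. -/
theorem IsGysinImage.unique (σ : Representation R (AutF ι) V) {p : ℕ}
    {c : groupCohomology (pullback R ι σ) (p + 1)} {d d' : groupCohomology (homH R ι σ) p}
    (hd : IsGysinImage σ c d) (hd' : IsGysinImage σ c d') : d = d' := by
  obtain ⟨f, v, ⟨hf, rfl⟩, hn, hF, ⟨hv, rfl⟩, hs⟩ := hd
  obtain ⟨f', v', ⟨hf', hff'⟩, hn', hF', ⟨hv', rfl⟩, hs'⟩ := hd'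
  have hv0 : coboundary (homH R ι σ) p (v - v') = 0 := by
    rw [coboundary_sub, hv, hv', sub_self]
  have hf0 : coboundary (pullback R ι σ) (p + 1) (f - f') = 0 := by
    rw [coboundary_sub, hf, hf', sub_self]
  refine sub_eq_zero.1 ((cls_sub (A := homH R ι σ) v v' hv hv' hv0).symm.trans ?_)
  have h0 : cls (A := pullback R ι σ) (f - f') hf0 = 0 :=
    (cls_sub (A := pullback R ι σ) f f' hf hf' hf0).trans (by rw [hff', sub_self])
  obtain ⟨b, hb⟩ := (cls_eq_zero_iff _ _).1 h0
  have hs0 : ∀ φ γ, (v - v') φ (homologyClass R γ) = shuffle (f - f') γ φ := fun φ γ => by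
    refine Eq.trans ?_ (shuffle_sub f f' γ φ).symm
    rw [← hs, ← hs']
    rfl
  -- In degree zero a primitive of `f - f'` is a single vector. Its coboundary vanishes on `F`,
  -- which acts trivially, so even the cochains `v` and `v'` coincide.
  cases p with
  | zero =>
    refine cls_of_eq_zero _ _ ?_
    funext φ
    refine H.hom_ext fun γ => ?_
    rw [hs0, shuffle_zero, ← hb, coboundary_eq_faces, faces_zero]
    change σ 1 _ + _ = _
    rw [map_one, ← sub_eq_add_neg]
    exact sub_eq_zero.2 (congrArg b (Subsingleton.elim _ _))
  | succ m =>
    refine (cls_eq_zero_iff _ _).2 ?_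
    refine exists_coboundary_eq_of_shuffle m σ b (f - f') (v - v') hb ?_ ?_ hv0 hs0
    · intro g hg
      rw [Pi.sub_apply, hn g hg, hn' g hg, sub_self]
    · intro g hg
      rw [Pi.sub_apply, hF g hg, hF' g hg, sub_self]

end GysinUniqueness

/-! ### Contractions and derivations of tensor powers. -/

section Tensors

variable {R ι : Type u} [CommRing R]

theorem mulPow_assoc {a b c ab bc n : ℕ} (h₁ : a + b = ab) (h₂ : ab + c = n) (h₃ : b + c = bc)
    (h₄ : a + bc = n) (x : HPow R ι a) (y : HPow R ι b) (z : HPow R ι c) :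
    mulPow R ι h₂ (mulPow R ι h₁ (x ⊗ₜ y) ⊗ₜ z) = mulPow R ι h₄ (x ⊗ₜ mulPow R ι h₃ (y ⊗ₜ z)) := by
  induction x using HPow.induction with
  | h2 x x' hx hx' => simp only [TensorProduct.add_tmul, map_add, hx, hx']
  | h1 r x =>
    induction y using HPow.induction with
    | h2 y y' hy hy' =>
      simp only [TensorProduct.add_tmul, TensorProduct.tmul_add, map_add, hy, hy']
    | h1 s y =>
      induction z using HPow.induction with
      | h2 z z' hz hz' => simp only [TensorProduct.tmul_add, map_add, hz, hz']
      | h1 t z =>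
        simp only [← TensorProduct.smul_tmul', TensorProduct.tmul_smul, map_smul,
          mulPow_pureTensor]
        congr 4
        subst h₁ h₃ h₂
        funext i
        simp [Fin.append_assoc]

theorem HPow.mul_induction {a b c : ℕ} (h : a + b = c) {P : HPow R ι c → Prop}
    (h0 : P 0) (hmul : ∀ x y, P (mulPow R ι h (x ⊗ₜ y))) (hadd : ∀ x y, P x → P y → P (x + y))
    (x : HPow R ι c) : P x := by
  obtain ⟨z, rfl⟩ := (mulPow R ι h).surjective x
  induction z using TensorProduct.induction_on with
  | zero => rwa [map_zero]
  | tmul x y => exact hmul x y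
  | add z z' hz hz' =>
    rw [map_add]
    exact hadd _ _ hz hz'

/-- Linear maps on `H^{⊗2}` agree if they agree on the tensors `x ⊗ y`. -/
theorem HPow.hom_ext₂ {V : Type*} [AddCommGroup V] [Module R V] {f g : HPow R ι 2 →ₗ[R] V}
    (h : ∀ x y : H R ι, f (mulPow R ι (rfl : 1 + 1 = 2) (toPowOne R ι x ⊗ₜ toPowOne R ι y)) =
      g (mulPow R ι (rfl : 1 + 1 = 2) (toPowOne R ι x ⊗ₜ toPowOne R ι y))) : f = g := by
  refine LinearMap.ext fun s => ?_
  induction s using HPow.mul_induction (rfl : 1 + 1 = 2) with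
  | h0 => rw [map_zero, map_zero]
  | hadd s s' hs hs' => rw [map_add, map_add, hs, hs']
  | hmul x y =>
    obtain ⟨x, rfl⟩ := (toPowOne R ι).surjective x
    obtain ⟨y, rfl⟩ := (toPowOne R ι).surjective y
    exact h x y

variable (R ι) in
/-- The inclusion `H → H^{⊗1}` as an element of `H^* ⊗ H`. -/
def oneHom : H R ι →ₗ[R] HPow R ι 1 := (toPowOne R ι).toLinearMap

theorem oneHom_apply (x : H R ι) : oneHom R ι x = toPowOne R ι x := rfl

theorem homPow_oneHom (φ : AutF ι) : (homPow R ι 1).ρ φ (oneHom R ι) = oneHom R ι :=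
  H.hom_ext fun γ => by
    rw [homH_apply, oneHom_apply, oneHom_apply, rhoPow_toPowOne, rhoH_homologyClass,
      MulAut.apply_inv_self]

/-- `(u, v) ↦ u ⊗ v ⊗ 1_H`. -/
def tensorHomOneBilin {a b c : ℕ} (h : a + b + 1 = c) :
    (H R ι →ₗ[R] HPow R ι a) →ₗ[R] (H R ι →ₗ[R] HPow R ι b) →ₗ[R]
      (HPow R ι 3 →ₗ[R] HPow R ι c) :=
  LinearMap.compr₂ (tensorHomBilin R ι (rfl : a + b = a + b))
    ((LinearMap.lcomp R _ (mulPow R ι (rfl : 2 + 1 = 3)).symm.toLinearMap) ∘ₗ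
      (LinearMap.llcomp R _ _ _ (mulPow R ι h).toLinearMap) ∘ₗ LinearMap.rTensorHom (HPow R ι 1))

theorem tensorHomOneBilin_apply {a b c : ℕ} (h : a + b + 1 = c) (u : H R ι →ₗ[R] HPow R ι a)
    (v : H R ι →ₗ[R] HPow R ι b) (x : HPow R ι 2) (y : HPow R ι 1) :
    tensorHomOneBilin h u v (mulPow R ι (rfl : 2 + 1 = 3) (x ⊗ₜ y)) =
      mulPow R ι h (tensorHomBilin R ι rfl u v x ⊗ₜ y) := by
  simp [tensorHomOneBilin]

theorem tensorHomOneBilin_equivariant {a b c : ℕ} (h : a + b + 1 = c) (φ : AutF ι)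
    (u : H R ι →ₗ[R] HPow R ι a) (v : H R ι →ₗ[R] HPow R ι b) :
    tensorHomOneBilin h ((homPow R ι a).ρ φ u) ((homPow R ι b).ρ φ v) =
      ((rhoPow R ι 3).linHom (rhoPow R ι c)) φ (tensorHomOneBilin h u v) := by
  refine LinearMap.ext fun s => ?_
  induction s using HPow.mul_induction (rfl : 2 + 1 = 3) with
  | h0 => rw [map_zero, map_zero]
  | hadd s s' hs hs' => rw [map_add, map_add, hs, hs']
  | hmul x y =>
    rw [tensorHomOneBilin_apply, tensorHomBilin_equivariant, Representation.linHom_apply,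
      Representation.linHom_apply]
    simp only [LinearMap.comp_apply]
    rw [rhoPow_mulPow, tensorHomOneBilin_apply, rhoPow_mulPow, Representation.self_inv_apply]

/-- The derivation `t ⊗ 1_H + 1_H ⊗ t : H^{⊗2} → H^{⊗3}` extending `t : H → H^{⊗2}`. -/
def derivation (t : H R ι →ₗ[R] HPow R ι 2) : HPow R ι 2 →ₗ[R] HPow R ι 3 :=
  tensorHomBilin R ι (rfl : 2 + 1 = 3) t (oneHom R ι) +
    tensorHomBilin R ι (rfl : 1 + 2 = 3) (oneHom R ι) t

theorem derivation_add (t t' : H R ι →ₗ[R] HPow R ι 2) :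
    derivation (t + t') = derivation t + derivation t' := by
  rw [derivation, derivation, derivation, map_add, map_add, LinearMap.add_apply]
  abel

theorem derivation_apply (t : H R ι →ₗ[R] HPow R ι 2) (x y : H R ι) :
    derivation t (mulPow R ι (rfl : 1 + 1 = 2) (toPowOne R ι x ⊗ₜ toPowOne R ι y)) =
      mulPow R ι rfl (t x ⊗ₜ toPowOne R ι y) + mulPow R ι rfl (toPowOne R ι x ⊗ₜ t y) := by
  rw [derivation, LinearMap.add_apply, tensorHomBilin_apply, tensorHomBilin_apply, oneHom_apply,
    oneHom_apply]

theorem derivation_equivariant (φ : AutF ι) (t : H R ι →ₗ[R] HPow R ι 2) (s : HPow R ι 2) :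
    derivation ((homPow R ι 2).ρ φ t) (rhoPow R ι 2 φ s) = rhoPow R ι 3 φ (derivation t s) := by
  have h₁ := tensorHomBilin_equivariant R ι (rfl : 2 + 1 = 3) φ t (oneHom R ι)
  have h₂ := tensorHomBilin_equivariant R ι (rfl : 1 + 2 = 3) φ (oneHom R ι) t
  rw [homPow_oneHom] at h₁ h₂
  have h₃ : ∀ u : HPow R ι 2 →ₗ[R] HPow R ι 3, ((homPow₂ R ι 3).ρ φ u : HPow R ι 2 →ₗ[R] HPow R ι 3)
      (rhoPow R ι 2 φ s) = rhoPow R ι 3 φ (u s) := fun u => by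
    rw [Representation.linHom_apply, LinearMap.comp_apply, LinearMap.comp_apply,
      Representation.inv_self_apply]
  rw [derivation, derivation, h₁, h₂, LinearMap.add_apply, LinearMap.add_apply, map_add, h₃, h₃]

/-- `u ⊗ ((v ⊗ 1) ∘ t) + ((u ⊗ v) ∘ t) ⊗ 1 = (u ⊗ v ⊗ 1) ∘ (t ⊗ 1 + 1 ⊗ t)`. -/
theorem tensorHom_derivation {a b c b' n : ℕ} (u : H R ι →ₗ[R] HPow R ι a)
    (v : H R ι →ₗ[R] HPow R ι b) (t : H R ι →ₗ[R] HPow R ι 2) (h₁ : b + 1 = b') (h₂ : a + b' = n)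
    (h₃ : a + b = c) (h₄ : c + 1 = n) (h₅ : a + b + 1 = n) :
    tensorHomBilin R ι h₂ u (tensorHomBilin R ι h₁ v (oneHom R ι) ∘ₗ t) +
      tensorHomBilin R ι h₄ (tensorHomBilin R ι h₃ u v ∘ₗ t) (oneHom R ι) =
    tensorHomOneBilin h₅ u v ∘ₗ derivation t := by
  subst h₃
  refine HPow.hom_ext₂ fun x y => ?_
  rw [LinearMap.add_apply, LinearMap.comp_apply, derivation_apply, map_add,
    tensorHomOneBilin_apply, tensorHomBilin_apply, tensorHomBilin_apply, LinearMap.comp_apply,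
    LinearMap.comp_apply, add_comm]
  refine congrArg₂ (· + ·) rfl ?_
  -- The other summand agrees by definition. Here only `t y` has to be decomposed: on a product `y ⊗
  -- z` both sides are `u x ⊗ v y ⊗ z`, bracketed differently.
  generalize t y = s
  induction s using HPow.mul_induction (rfl : 1 + 1 = 2) with
  | h0 => simp
  | hadd s s' hs hs' => simp only [TensorProduct.tmul_add, map_add, hs, hs']
  | hmul y z =>
    obtain ⟨y, rfl⟩ := (toPowOne R ι).surjective y
    obtain ⟨z, rfl⟩ := (toPowOne R ι).surjective z
    rw [← mulPow_assoc (rfl : 1 + 1 = 2) (rfl : 2 + 1 = 3), tensorHomOneBilin_apply,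
      tensorHomBilin_apply, tensorHomBilin_apply, oneHom_apply,
      mulPow_assoc rfl h₅ h₁ h₂]

end Tensors

/-! ### Magnus expansion up to degree three and the Johnson maps. -/

section Magnus

variable (R ι : Type u) [CommRing R]

theorem homologyClass_one : homologyClass R (1 : F ι) = 0 := by
  have := homologyClass_mul R ι 1 1
  rw [mul_one] at this
  exact left_eq_add.1 this

variable {R ι} in
-- The case of trivial action. It builds a Magnus expansion degree by degree: the lower degrees
-- prescribe the additivity defect of the next one, and associativity of the tensor algebra makes
-- that defect a cocycle.
theorem exists_cochain_of_bilinear_defect {V : Type u} [AddCommGroup V] (c : F ι → F ι → V)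
    (hc : ∀ x y z, c y z + c x (y * z) = c (x * y) z + c x y) (h1 : ∀ x, c 1 x = 0) :
    ∃ b : F ι → V, ∀ x y, b (x * y) = b x + b y + c x y := by
  obtain ⟨b, hb, -⟩ := exists_cochain_of_free (1 : FreeGroup ι →* AddMonoid.End V) c hc h1 0
  exact ⟨b, hb⟩

theorem exists_magnus₂ : ∃ θ : F ι → HPow R ι 2, ∀ γ δ, θ (γ * δ) = θ γ + θ δ +
    mulPow R ι rfl (toPowOne R ι (homologyClass R γ) ⊗ₜ toPowOne R ι (homologyClass R δ)) := by
  refine exists_cochain_of_bilinear_defect _ (fun x y z => ?_) (fun x => ?_)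
  · simp only [homologyClass_mul, map_add, TensorProduct.add_tmul, TensorProduct.tmul_add]
    abel
  · simp [homologyClass_one]

/-- The part of degree `2` of a Magnus expansion of `F`. -/
def magnus₂ : F ι → HPow R ι 2 := (exists_magnus₂ R ι).choose

theorem magnus₂_mul (γ δ : F ι) : magnus₂ R ι (γ * δ) = magnus₂ R ι γ + magnus₂ R ι δ +
    mulPow R ι rfl (toPowOne R ι (homologyClass R γ) ⊗ₜ toPowOne R ι (homologyClass R δ)) :=
  (exists_magnus₂ R ι).choose_spec γ δ

theorem magnus₂_one : magnus₂ R ι 1 = 0 := by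
  have := magnus₂_mul R ι 1 1
  rw [mul_one, homologyClass_one, map_zero, TensorProduct.zero_tmul, map_zero, add_zero] at this
  exact left_eq_add.1 this

theorem exists_magnus₃ : ∃ θ : F ι → HPow R ι 3, ∀ γ δ, θ (γ * δ) = θ γ + θ δ +
    (mulPow R ι rfl (magnus₂ R ι γ ⊗ₜ toPowOne R ι (homologyClass R δ)) +
      mulPow R ι rfl (toPowOne R ι (homologyClass R γ) ⊗ₜ magnus₂ R ι δ)) := by
  refine exists_cochain_of_bilinear_defect _ (fun x y z => ?_) (fun x => ?_)
  · simp only [homologyClass_mul, magnus₂_mul, map_add, TensorProduct.add_tmul,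
      TensorProduct.tmul_add, mulPow_assoc (rfl : 1 + 1 = 2) (rfl : 2 + 1 = 3) (rfl : 1 + 1 = 2)
        (rfl : 1 + 2 = 3)]
    abel
  · simp [homologyClass_one, magnus₂_one]

/-- The part of degree `3` of a Magnus expansion of `F`. -/
def magnus₃ : F ι → HPow R ι 3 := (exists_magnus₃ R ι).choose

theorem magnus₃_mul (γ δ : F ι) : magnus₃ R ι (γ * δ) = magnus₃ R ι γ + magnus₃ R ι δ +
    (mulPow R ι rfl (magnus₂ R ι γ ⊗ₜ toPowOne R ι (homologyClass R δ)) +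
      mulPow R ι rfl (toPowOne R ι (homologyClass R γ) ⊗ₜ magnus₂ R ι δ)) :=
  (exists_magnus₃ R ι).choose_spec γ δ

/-- Conjugating a Magnus expansion by `φ` gives another one with the same degree-one part. Hence the
degree-two parts have the same additivity defect and differ by a homomorphism. -/
theorem exists_johnson₁ (φ : AutF ι) : ∃ τ : H R ι →ₗ[R] HPow R ι 2, ∀ γ,
    τ (homologyClass R γ) = magnus₂ R ι γ - rhoPow R ι 2 φ (magnus₂ R ι (φ⁻¹ γ)) := by
  refine exists_linearMap_of_additive _ fun γ δ => ?_
  simp only [map_mul, magnus₂_mul, map_add, rhoPow_mulPow, rhoPow_toPowOne, rhoH_homologyClass,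
    MulAut.apply_inv_self]
  abel

/-- The first Johnson map `τ₁`, with `τ₁(φ)[γ] = θ₂(γ) - |φ|^{⊗2} θ₂(φ⁻¹ γ)`. -/
def johnson₁ (φ : AutF ι) : H R ι →ₗ[R] HPow R ι 2 := (exists_johnson₁ R ι φ).choose

theorem johnson₁_homologyClass (φ : AutF ι) (γ : F ι) : johnson₁ R ι φ (homologyClass R γ) =
    magnus₂ R ι γ - rhoPow R ι 2 φ (magnus₂ R ι (φ⁻¹ γ)) :=
  (exists_johnson₁ R ι φ).choose_spec γ

theorem johnson₁_one : johnson₁ R ι 1 = 0 := H.hom_ext fun γ => by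
  simp [johnson₁_homologyClass]

theorem johnson₁_mul (φ ψ : AutF ι) :
    johnson₁ R ι (φ * ψ) = johnson₁ R ι φ + (homPow R ι 2).ρ φ (johnson₁ R ι ψ) :=
  H.hom_ext fun γ => by
    rw [LinearMap.add_apply, homH_apply]
    simp [johnson₁_homologyClass]

/-- The expansion and its conjugate by `φ` are related by an automorphism of the truncated tensor
algebra which on `H` is `1 + τ₁ + τ₂`. On `H^{⊗2}` its part of degree one is the derivation
extending `τ₁`; once that contribution is removed, the degree-three difference is additive. -/
theorem exists_johnson₂ (φ : AutF ι) : ∃ τ : H R ι →ₗ[R] HPow R ι 3, ∀ γ,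
    τ (homologyClass R γ) = magnus₃ R ι γ - rhoPow R ι 3 φ (magnus₃ R ι (φ⁻¹ γ)) -
      derivation (johnson₁ R ι φ) (rhoPow R ι 2 φ (magnus₂ R ι (φ⁻¹ γ))) := by
  refine exists_linearMap_of_additive _ fun γ δ => ?_
  simp only [map_mul, magnus₂_mul, magnus₃_mul, map_add, rhoPow_mulPow, rhoPow_toPowOne,
    rhoH_homologyClass, MulAut.apply_inv_self, derivation_apply, johnson₁_homologyClass,
    TensorProduct.sub_tmul, TensorProduct.tmul_sub, map_sub]
  abel

/-- The second Johnson map, with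
`τ₂(φ)[γ] = θ₃(γ) - |φ|^{⊗3} θ₃(φ⁻¹ γ) - (τ₁(φ) ⊗ 1 + 1 ⊗ τ₁(φ)) |φ|^{⊗2} θ₂(φ⁻¹ γ)`. -/
def johnson₂ (φ : AutF ι) : H R ι →ₗ[R] HPow R ι 3 := (exists_johnson₂ R ι φ).choose

theorem johnson₂_homologyClass (φ : AutF ι) (γ : F ι) : johnson₂ R ι φ (homologyClass R γ) =
    magnus₃ R ι γ - rhoPow R ι 3 φ (magnus₃ R ι (φ⁻¹ γ)) -
      derivation (johnson₁ R ι φ) (rhoPow R ι 2 φ (magnus₂ R ι (φ⁻¹ γ))) :=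
  (exists_johnson₂ R ι φ).choose_spec γ

/-- The degree-three part of the rule that the automorphism attached to `φ ψ` is the one attached to
`φ` composed with the `φ`-conjugate of the one attached to `ψ`. -/
theorem johnson₂_mul (φ ψ : AutF ι) :
    (homPow R ι 3).ρ φ (johnson₂ R ι ψ) - johnson₂ R ι (φ * ψ) + johnson₂ R ι φ =
      -(derivation (johnson₁ R ι φ) ∘ₗ (homPow R ι 2).ρ φ (johnson₁ R ι ψ)) :=
  H.hom_ext fun γ => by
    rw [LinearMap.add_apply, LinearMap.sub_apply, homH_apply, LinearMap.neg_apply,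
      LinearMap.comp_apply, homH_apply]
    simp only [johnson₂_homologyClass, johnson₁_homologyClass, map_sub, mul_inv_rev,
      MulAut.mul_apply, map_mul, Module.End.mul_apply]
    rw [johnson₁_mul, derivation_add, LinearMap.add_apply, derivation_equivariant]
    abel

end Magnus

/-! ### Gysin images of products with `k₀`. -/

section Pairing

variable {R ι : Type u} [CommRing R]

theorem coboundary_degree_one {G : Type u} [Group G] (A : Rep.{u} R G) (f : (Fin 1 → G) → A)
    (x : Fin 2 → G) : coboundary A 1 f x =
      A.ρ (x 0) (f fun _ => x 1) - f (fun _ => x 0 * x 1) + f fun _ => x 0 := by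
  have h : ∀ y z : Fin 1 → G, y 0 = z 0 → f y = f z := fun y z hyz =>
    congrArg f (funext fun i => by rw [Subsingleton.elim i 0, hyz])
  rw [coboundary_eq_faces, ← Fin.cons_self_tail x, faces_cons, faces_zero, sub_neg_eq_add,
    ← add_assoc, ← sub_eq_add_neg]
  refine congrArg₂ (· + ·) (congrArg₂ (· - ·) (congrArg _ (h _ _ rfl)) (h _ _ rfl)) (h _ _ rfl)

theorem isNormalized_cupFun {G : Type u} [Group G] {A B C : Rep.{u} R G}
    (β : A →ₗ[R] B →ₗ[R] C) {p q : ℕ} {f : (Fin p → G) → A} {g : (Fin q → G) → B}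
    (hf : IsNormalized f) (hg : IsNormalized g) : IsNormalized (cupFun β f g) := by
  rintro x ⟨i, hi⟩
  induction i using Fin.addCases with
  | left i => rw [cupFun, hf _ ⟨i, hi⟩, map_zero, LinearMap.zero_apply]
  | right i => rw [cupFun, hg _ ⟨i, hi⟩, map_zero, map_zero]

/-- The inflation to `F ⋊ Aut(F)` of a cochain of `Aut(F)`. -/
def inflate {M : Type*} {n : ℕ} (T : (Fin n → AutF ι) → M) (t : Fin n → AutFBar ι) : M :=
  T fun i => (t i).right

theorem coboundary_inflate {M : Type u} [AddCommGroup M] [Module R M]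
    (μ : Representation R (AutF ι) M) {n : ℕ} (T : (Fin n → AutF ι) → M)
    (hT : coboundary (Rep.of μ) n T = 0) :
    coboundary (pullback R ι μ) n (inflate T) = 0 := by
  funext t
  rw [coboundary_eq_faces]
  refine (congrArg₂ (· + ·) rfl
    (faces_comp_hom (SemidirectProduct.rightHom : AutFBar ι →* AutF ι) T t)).trans ?_
  exact (coboundary_eq_faces (Rep.of μ) T fun i => (t i).right).symm.trans (congrFun hT _)

section

variable {V : Type u} [AddCommGroup V] [Module R V] (σ : Representation R (AutF ι) V)

variable (R ι V) in
/-- The evaluation `Hom(H, V) × H^{⊗1} → V`. -/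
def evalBilin : (H R ι →ₗ[R] V) →ₗ[R] HPow R ι 1 →ₗ[R] V :=
  LinearMap.lcomp R V (toPowOne R ι).symm.toLinearMap

theorem evalBilin_apply (u : H R ι →ₗ[R] V) (x : H R ι) :
    evalBilin R ι V u (toPowOne R ι x) = u x := by
  simp [evalBilin]

theorem evalBilin_equivariant (g : AutFBar ι) (u : H R ι →ₗ[R] V) (y : HPow R ι 1) :
    evalBilin R ι V ((pullback R ι ((rhoH R ι).linHom σ)).ρ g u)
      ((pullback R ι (rhoPow R ι 1)).ρ g y) = (pullback R ι σ).ρ g (evalBilin R ι V u y) := by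
  obtain ⟨y, rfl⟩ := (toPowOne R ι).surjective y
  change evalBilin R ι V _ (rhoPow R ι 1 g.right _) = σ g.right _
  rw [rhoPow_toPowOne, evalBilin_apply, evalBilin_apply]
  change σ g.right (u (rhoH R ι g.right⁻¹ (rhoH R ι g.right y))) = _
  rw [Representation.inv_self_apply]

/-- The cup product of a cochain of `Aut(F)` with coefficients in `Hom(H, V)` with `k₀`. -/
def pairK0 {p : ℕ} (T : (Fin p → AutF ι) → (H R ι →ₗ[R] V)) : (Fin (p + 1) → AutFBar ι) → V :=
  cupFun (A := pullback R ι ((rhoH R ι).linHom σ)) (B := pullback R ι (rhoPow R ι 1))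
    (C := pullback R ι σ) (evalBilin R ι V) (inflate T) (k0Fun R ι)

theorem pairK0_apply {p : ℕ} (T : (Fin p → AutF ι) → (H R ι →ₗ[R] V))
    (x : Fin (p + 1) → AutFBar ι) : pairK0 σ T x = T (fun i => (x i.castSucc).right)
      (homologyClass R ((List.ofFn fun i : Fin p => x i.castSucc).prod.right
        (x (Fin.last p)).left)) := by
  change evalBilin R ι V _ (rhoPow R ι 1 _ (toPowOne R ι _)) = _
  rw [rhoPow_toPowOne, evalBilin_apply, rhoH_homologyClass]
  rfl

theorem coboundary_pairK0 {p : ℕ} {T : (Fin p → AutF ι) → (H R ι →ₗ[R] V)}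
    (hT : coboundary (homH R ι σ) p T = 0) :
    coboundary (pullback R ι σ) (p + 1) (pairK0 σ T) = 0 :=
  coboundary_cupFun_eq_zero _ (evalBilin_equivariant σ) (coboundary_inflate _ T hT)
    (coboundary_k0Fun R ι)

theorem isNormalized_pairK0 {p : ℕ} {T : (Fin p → AutF ι) → (H R ι →ₗ[R] V)}
    (hT : IsNormalized T) : IsNormalized (pairK0 σ T) := by
  rintro x ⟨i, hi⟩
  rw [pairK0_apply]
  induction i using Fin.lastCases with
  | last => rw [hi, SemidirectProduct.one_left, map_one, homologyClass_one, map_zero]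
  | cast i => rw [hT _ ⟨i, by rw [hi, SemidirectProduct.one_right]⟩, LinearMap.zero_apply]

/-- Of two different positions at least one is not the last; there the inflated cochain sees the
argument `1`, and normalization of `T` applies. -/
theorem inFiltration_pairK0 {p : ℕ} {T : (Fin p → AutF ι) → (H R ι →ₗ[R] V)}
    (hT : IsNormalized T) : InFiltration (pairK0 σ T) := by
  rintro x ⟨i, j, hij, hi, hj⟩
  rw [pairK0_apply]
  induction i using Fin.lastCases with
  | last =>
    induction j using Fin.lastCases with
    | last => exact absurd rfl hij
    | cast j => rw [hT _ ⟨j, hj⟩, LinearMap.zero_apply]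
  | cast i => rw [hT _ ⟨i, hi⟩, LinearMap.zero_apply]

/-- Since `k₀` vanishes on `Aut(F)`, only the shuffle with `γ` last survives. It has sign `(-1)^p`,
and the translation by `φ₁⋯φ_p` in the cup product cancels the inverse in the shuffle. -/
theorem shuffle_pairK0 {p : ℕ} (T : (Fin p → AutF ι) → (H R ι →ₗ[R] V)) (γ : F ι)
    (φ : Fin p → AutF ι) :
    shuffle (pairK0 σ T) γ φ = (-1 : ℤ) ^ p • T φ (homologyClass R γ) := by
  induction p generalizing γ with
  | zero =>
    rw [shuffle_zero, pairK0_apply, Subsingleton.elim (fun i : Fin 0 => _) φ]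
    simp
  | succ p ih =>
    obtain ⟨a, φ, rfl⟩ : ∃ b ψ, φ = Fin.cons b ψ := ⟨φ 0, Fin.tail φ, (Fin.cons_self_tail φ).symm⟩
    have e : (fun t : Fin (p + 1) → AutFBar ι => pairK0 σ T (Fin.cons (inr a) t)) =
        pairK0 σ fun ψ => T (Fin.cons a ψ) ∘ₗ rhoH R ι a := by
      funext t
      rw [pairK0_apply, pairK0_apply, LinearMap.comp_apply, rhoH_homologyClass]
      have e1 : (fun i : Fin (p + 1) =>
          ((Fin.cons (inr a) t : Fin (p + 2) → AutFBar ι) i.castSucc).right) =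
          Fin.cons a fun i : Fin p => (t i.castSucc).right := by
        funext i
        induction i using Fin.cases with
        | zero => simp
        | succ i => rw [← Fin.succ_castSucc, Fin.cons_succ, Fin.cons_succ]
      rw [e1, List.ofFn_succ, ← Fin.succ_last]
      simp
    rw [shuffle_cons, e, ih, pairK0_apply, LinearMap.comp_apply, rhoH_homologyClass,
      MulAut.apply_inv_self, pow_succ]
    have h0 : ((Fin.cons (inl γ) (Fin.cons (inr a) fun j => inr (φ j) : Fin (p + 1) → AutFBar ι) :
        Fin (p + 2) → AutFBar ι) (Fin.last (p + 1))).left = 1 := by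
      rw [← Fin.succ_last, Fin.cons_succ]
      induction Fin.last p using Fin.cases <;> simp
    rw [h0, map_one, homologyClass_one, map_zero]
    simp

theorem isGysinImage_pairK0 {p : ℕ} (T : (Fin p → AutF ι) → (H R ι →ₗ[R] V))
    (hn : IsNormalized T) (hT : coboundary (homH R ι σ) p T = 0) :
    IsGysinImage σ (cls (A := pullback R ι σ) (pairK0 σ T) (coboundary_pairK0 σ hT))
      ((-1 : ℤ) ^ p • cls (A := homH R ι σ) T hT) := by
  have h : ∃ h : coboundary (homH R ι σ) p (fun φ => (-1 : ℤ) ^ p • T φ) = 0,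
      cls (A := homH R ι σ) (fun φ => (-1 : ℤ) ^ p • T φ) h =
        (-1 : ℤ) ^ p • cls (A := homH R ι σ) T hT := by
    rcases neg_one_pow_eq_or ℤ p with hp | hp
    · simp only [hp, one_smul]
      exact ⟨hT, trivial⟩
    · simp only [hp, neg_one_smul]
      have h : coboundary (homH R ι σ) p (-T) = 0 := by rw [coboundary_neg, hT, neg_zero]
      exact ⟨h, cls_neg (A := homH R ι σ) T hT h⟩
  exact ⟨pairK0 σ T, _, ⟨_, rfl⟩, isNormalized_pairK0 σ hn, inFiltration_pairK0 σ hn, h,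
    fun φ γ => (shuffle_pairK0 σ T γ φ).symm⟩

end

end Pairing

/-! ### Rewriting the powers of `k₀` as products `T_p ∪ k₀`. -/

section Powers

variable {R ι : Type u} [CommRing R]

theorem gysin_eq {V : Type u} [AddCommGroup V] [Module R V] (σ : Representation R (AutF ι) V)
    {p : ℕ} {c : groupCohomology (pullback R ι σ) (p + 1)} {d : groupCohomology (homH R ι σ) p}
    (h : IsGysinImage σ c d) : gysin σ c = d := by
  have hex : ∃! d, IsGysinImage σ c d := ⟨d, h, fun d' h' => h'.unique σ h⟩
  rw [gysin, dif_pos hex]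
  exact hex.choose_spec.1.unique σ h

theorem pairK0_seq {V : Type u} [AddCommGroup V] [Module R V] (σ : Representation R (AutF ι) V)
    {p : ℕ} (T : (Fin p → AutF ι) → (H R ι →ₗ[R] V)) (x : ℕ → AutFBar ι) :
    pairK0 σ T (fun i => x i) = T (fun i => (x i).right)
      (homologyClass R ((seqProd p x).right (x p).left)) :=
  pairK0_apply σ T _

theorem right_seqProd (p : ℕ) (x : ℕ → AutFBar ι) :
    (seqProd p x).right = seqProd p fun i => (x i).right := by
  induction p with
  | zero => rfl
  | succ p ih => rw [seqProd_succ', seqProd_succ', SemidirectProduct.mul_right, ih]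

variable (R ι) in
/-- The cocycle `τ₁` of `Aut(F)`. -/
def johnsonFun (x : Fin 1 → AutF ι) : H R ι →ₗ[R] HPow R ι 2 := johnson₁ R ι (x 0)

variable (R ι) in
theorem coboundary_johnsonFun : coboundary (homPow R ι 2) 1 (johnsonFun R ι) = 0 := by
  funext x
  rw [coboundary_degree_one]
  change (homPow R ι 2).ρ (x 0) (johnson₁ R ι (x 1)) - johnson₁ R ι (x 0 * x 1) +
    johnson₁ R ι (x 0) = 0
  rw [johnson₁_mul]
  abel

variable (R ι) in
theorem coboundary_neg_johnsonFun : coboundary (homPow R ι 2) 1 (-johnsonFun R ι) = 0 := by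
  refine (coboundary_neg (homPow R ι 2) 1 (johnsonFun R ι)).trans ?_
  rw [coboundary_johnsonFun, neg_zero]

variable (R ι) in
theorem coboundary_oneHom : coboundary (homPow R ι 1) 0 (fun _ => oneHom R ι) = 0 := by
  funext x
  rw [coboundary_eq_faces, faces_zero]
  refine (congrArg₂ (· + ·) (homPow_oneHom (x 0)) rfl).trans (add_neg_cancel _)

variable (R ι) in
theorem oneClass_eq : oneClass R ι =
    cls (A := homPow R ι 1) (fun _ => oneHom R ι) (coboundary_oneHom R ι) := rfl

/-- The cup product `f ⊗ g`, with coefficients in `Hom(H^{⊗2}, H^{⊗(q+r+2)})`. -/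
def tensorFun {q r : ℕ} (f : (Fin q → AutF ι) → (H R ι →ₗ[R] HPow R ι (q + 1)))
    (g : (Fin r → AutF ι) → (H R ι →ₗ[R] HPow R ι (r + 1))) :
    (Fin (q + r) → AutF ι) → (HPow R ι 2 →ₗ[R] HPow R ι (q + r + 1 + 1)) :=
  cupFun (A := homPow R ι (q + 1)) (B := homPow R ι (r + 1)) (C := homPow₂ R ι (q + r + 1 + 1))
    (tensorHomBilin R ι (by omega)) f g

/-- The cochain `(f ⊗ g) ∘ t`. -/
def graftFun {q r : ℕ} (f : (Fin q → AutF ι) → (H R ι →ₗ[R] HPow R ι (q + 1)))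
    (g : (Fin r → AutF ι) → (H R ι →ₗ[R] HPow R ι (r + 1)))
    (t : (Fin 1 → AutF ι) → (H R ι →ₗ[R] HPow R ι 2)) :
    (Fin (q + r + 1) → AutF ι) → (H R ι →ₗ[R] HPow R ι (q + r + 1 + 1)) :=
  cupFun (A := homPow₂ R ι (q + r + 1 + 1)) (B := homPow R ι 2) (C := homPow R ι (q + r + 1 + 1))
    (compBilin R ι _) (tensorFun f g) t

section

variable {q r : ℕ} {f : (Fin q → AutF ι) → (H R ι →ₗ[R] HPow R ι (q + 1))}
  {g : (Fin r → AutF ι) → (H R ι →ₗ[R] HPow R ι (r + 1))}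
  {t : (Fin 1 → AutF ι) → (H R ι →ₗ[R] HPow R ι 2)}

theorem coboundary_tensorFun (hf : coboundary (homPow R ι (q + 1)) q f = 0)
    (hg : coboundary (homPow R ι (r + 1)) r g = 0) :
    coboundary (homPow₂ R ι (q + r + 1 + 1)) (q + r) (tensorFun f g) = 0 :=
  coboundary_cupFun_eq_zero _ (tensorHomBilin_equivariant R ι _) hf hg

theorem coboundary_graftFun (hf : coboundary (homPow R ι (q + 1)) q f = 0)
    (hg : coboundary (homPow R ι (r + 1)) r g = 0) (ht : coboundary (homPow R ι 2) 1 t = 0) :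
    coboundary (homPow R ι (q + r + 1 + 1)) (q + r + 1) (graftFun f g t) = 0 :=
  coboundary_cupFun_eq_zero _ (compBilin_equivariant R ι _) (coboundary_tensorFun hf hg) ht

theorem isNormalized_graftFun (hf : IsNormalized f) (hg : IsNormalized g) (ht : IsNormalized t) :
    IsNormalized (graftFun f g t) :=
  isNormalized_cupFun _ (isNormalized_cupFun _ hf hg) ht

variable (f g t)

theorem tensorFun_seq (x : ℕ → AutF ι) : tensorFun f g (fun i => x i) =
    tensorHomBilin R ι (by omega) (f fun i => x i)
      ((homPow R ι (r + 1)).ρ (seqProd q x) (g fun j => x (q + j))) := rfl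

theorem graftFun_seq (x : ℕ → AutF ι) : graftFun f g t (fun i => x i) =
    tensorFun f g (fun i => x i) ∘ₗ
      (homPow R ι 2).ρ (seqProd (q + r) x) (t fun j => x (q + r + j)) := rfl

end

theorem linHom_apply_apply {a b : ℕ} (φ : AutF ι) (u : HPow R ι a →ₗ[R] HPow R ι b)
    (s : HPow R ι a) :
    (rhoPow R ι a).linHom (rhoPow R ι b) φ u (rhoPow R ι a φ s) = rhoPow R ι b φ (u s) := by
  rw [Representation.linHom_apply, LinearMap.comp_apply, LinearMap.comp_apply,
    Representation.inv_self_apply]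

variable (R ι) in
/-- The cocycle `k₀ ∪ k₀`. -/
def k0Sq : (Fin 2 → AutFBar ι) → HPow R ι 2 :=
  cupFun (A := pullback R ι (rhoPow R ι 1)) (B := pullback R ι (rhoPow R ι 1))
    (C := pullback R ι (rhoPow R ι 2))
    ((TensorProduct.mk R _ _).compr₂ (mulPow R ι rfl).toLinearMap) (k0Fun R ι) (k0Fun R ι)

variable (R ι) in
theorem coboundary_k0Sq : coboundary (pullback R ι (rhoPow R ι 2)) 2 (k0Sq R ι) = 0 :=
  coboundary_cupFun_eq_zero _ (fun g a b => (rhoPow_mulPow R ι rfl g.right a b).symm)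
    (coboundary_k0Fun R ι) (coboundary_k0Fun R ι)

theorem k0Sq_apply (x : Fin 2 → AutFBar ι) : k0Sq R ι x =
    mulPow R ι rfl (toPowOne R ι (homologyClass R (x 0).left) ⊗ₜ
      toPowOne R ι (homologyClass R ((x 0).right (x 1).left))) := by
  change mulPow R ι rfl (toPowOne R ι _ ⊗ₜ rhoPow R ι 1 _ (toPowOne R ι _)) = _
  rw [rhoPow_toPowOne, rhoH_homologyClass]
  simp [List.ofFn_succ]

variable (R ι) in
/-- `k₀ ∪ k₀ = -τ₁ ∪ k₀` in cohomology. -/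
theorem cls_k0Sq : cls (A := pullback R ι (rhoPow R ι 2)) (k0Sq R ι) (coboundary_k0Sq R ι) =
    cls (A := pullback R ι (rhoPow R ι 2)) (pairK0 (rhoPow R ι 2) (-johnsonFun R ι))
      (coboundary_pairK0 _ (coboundary_neg_johnsonFun R ι)) := by
  have hd : coboundary (pullback R ι (rhoPow R ι 2)) 2
      (k0Sq R ι - pairK0 (rhoPow R ι 2) (-johnsonFun R ι)) = 0 := by
    refine (coboundary_sub (pullback R ι (rhoPow R ι 2)) 2 _ _).trans ?_
    rw [coboundary_k0Sq, coboundary_pairK0 _ (coboundary_neg_johnsonFun R ι), sub_zero]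
  refine sub_eq_zero.1 ((cls_sub (A := pullback R ι (rhoPow R ι 2)) _ _ _ _ hd).symm.trans ?_)
  -- The primitive is `-θ₂` of the `F`-component. On a product with `F`-component `γ₁ φ₁(γ₂)` the
  -- additivity defect of `θ₂` produces `k₀ ∪ k₀`, and the rest, `θ₂(φ₁γ₂) - |φ₁|^{⊗2} θ₂(γ₂)`, is
  -- `τ₁(φ₁)[φ₁γ₂]`.
  refine (cls_eq_zero_iff _ hd).2 ⟨fun x => -magnus₂ R ι (x 0).left, ?_⟩
  funext x
  rw [coboundary_degree_one]
  refine Eq.trans ?_ (congrArg₂ (· - ·) (k0Sq_apply x) (pairK0_apply (rhoPow R ι 2) _ x)).symm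
  change rhoPow R ι 2 (x 0).right (-magnus₂ R ι (x 1).left) - -magnus₂ R ι (x 0 * x 1).left +
    -magnus₂ R ι (x 0).left = _ - (-johnson₁ R ι (x 0).right) (homologyClass R _)
  have e : (List.ofFn fun i : Fin 1 => x i.castSucc).prod.right = (x 0).right := by
    simp [List.ofFn_succ]
  rw [e, LinearMap.neg_apply, johnson₁_homologyClass, SemidirectProduct.mul_left]
  change _ - -magnus₂ R ι ((x 0).left * (x 0).right (x 1).left) + _ = _ - -(magnus₂ R ι
    ((x 0).right (x 1).left) - _)
  rw [magnus₂_mul, MulAut.inv_apply_self, map_neg]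
  have aux : ∀ a b c m : HPow R ι 2, -a - -(b + c + m) + -b = m - -(c - a) := fun a b c m => by
    abel
  exact aux _ _ _ _

variable (R ι) in
/-- The cocycles `T_p` with `k₀^{⊗(p+1)} = T_p ∪ k₀` in cohomology. -/
def powCochain : (p : ℕ) → (Fin p → AutF ι) → (H R ι →ₗ[R] HPow R ι (p + 1))
  | 0 => fun _ => oneHom R ι
  | p + 1 => graftFun (powCochain p) (r := 0) (fun _ => oneHom R ι) (-johnsonFun R ι)

variable (R ι) in
theorem coboundary_powCochain (p : ℕ) :
    coboundary (homPow R ι (p + 1)) p (powCochain R ι p) = 0 := by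
  induction p with
  | zero => exact coboundary_oneHom R ι
  | succ p ih => exact coboundary_graftFun ih (coboundary_oneHom R ι) (coboundary_neg_johnsonFun R ι)

variable (R ι) in
theorem isNormalized_powCochain (p : ℕ) : IsNormalized (powCochain R ι p) := by
  induction p with
  | zero => exact fun _ ⟨i, _⟩ => i.elim0
  | succ p ih =>
    refine isNormalized_graftFun ih (fun _ ⟨i, _⟩ => i.elim0) ?_
    rintro x ⟨i, hi⟩
    rw [Subsingleton.elim i 0] at hi
    rw [Pi.neg_apply, johnsonFun, hi, johnson₁_one, neg_zero]

variable (R ι) in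
/-- The cochain `T_p ⊗ 1_H`, with coefficients in `Hom(H^{⊗2}, H^{⊗(p+2)})`. -/
def powTensor (p : ℕ) : (Fin p → AutF ι) → (HPow R ι 2 →ₗ[R] HPow R ι (p + 1 + 1)) :=
  tensorFun (powCochain R ι p) (r := 0) fun _ => oneHom R ι

variable (R ι) in
theorem coboundary_powTensor (p : ℕ) :
    coboundary (homPow₂ R ι (p + 1 + 1)) p (powTensor R ι p) = 0 :=
  coboundary_tensorFun (coboundary_powCochain R ι p) (coboundary_oneHom R ι)

/-- Associativity of the cup product on cochains: it isolates the factor `k₀ ∪ k₀`, so that this can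
be replaced within its class. -/
theorem k0Pow_step_left (p : ℕ) (x : ℕ → AutFBar ι) :
    cupFun (A := pullback R ι (rhoPow R ι (p + 1))) (B := pullback R ι (rhoPow R ι 1))
      (C := pullback R ι (rhoPow R ι (p + 1 + 1)))
      ((TensorProduct.mk R _ _).compr₂ (mulPow R ι rfl).toLinearMap)
      (pairK0 (rhoPow R ι (p + 1)) (powCochain R ι p)) (k0Fun R ι) (fun i => x i) =
    cupFun (A := pullback R ι ((rhoPow R ι 2).linHom (rhoPow R ι (p + 1 + 1))))
      (B := pullback R ι (rhoPow R ι 2)) (C := pullback R ι (rhoPow R ι (p + 1 + 1)))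
      LinearMap.id (inflate (powTensor R ι p))
      (k0Sq R ι) (fun i => x i) := by
  rw [cupFun_seq, cupFun_seq, pairK0_seq, k0Sq_apply]
  change mulPow R ι rfl (_ ⊗ₜ rhoPow R ι 1 (seqProd (p + 1) x).right (toPowOne R ι
    (homologyClass R (x (p + 1 + 0)).left))) =
    tensorFun (powCochain R ι p) (fun _ => oneHom R ι) (fun i => (x i).right)
      (rhoPow R ι 2 (seqProd p x).right (mulPow R ι rfl
        (toPowOne R ι (homologyClass R (x (p + 0)).left) ⊗ₜ toPowOne R ι
          (homologyClass R ((x (p + 0)).right (x (p + 1)).left)))))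
  rw [tensorFun_seq _ _ fun i => (x i).right, homPow_oneHom, rhoPow_mulPow, rhoPow_toPowOne,
    rhoPow_toPowOne, rhoPow_toPowOne, tensorHomBilin_apply, seqProd_succ', oneHom_apply]
  simp only [rhoH_homologyClass]
  rfl

/-- The same regrouping after the replacement: the factor `-τ₁` is absorbed into `T_p ⊗ 1`, which is
how `T_{p+1}` is defined. -/
theorem k0Pow_step_right (p : ℕ) (x : ℕ → AutFBar ι) :
    pairK0 (rhoPow R ι (p + 1 + 1)) (powCochain R ι (p + 1)) (fun i => x i) =
    cupFun (A := pullback R ι ((rhoPow R ι 2).linHom (rhoPow R ι (p + 1 + 1))))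
      (B := pullback R ι (rhoPow R ι 2)) (C := pullback R ι (rhoPow R ι (p + 1 + 1)))
      LinearMap.id (inflate (powTensor R ι p))
      (pairK0 (rhoPow R ι 2) (-johnsonFun R ι)) (fun i => x i) := by
  rw [cupFun_seq, pairK0_seq]
  rw [pairK0_seq (rhoPow R ι 2) (-johnsonFun R ι) (fun j => x (p + j))]
  have e : powCochain R ι (p + 1) (fun i => (x i).right) =
      powTensor R ι p (fun i => (x i).right) ∘ₗ
        (homPow R ι 2).ρ (seqProd p fun i => (x i).right)
          ((-johnsonFun R ι) fun j => (x (p + j)).right) := rfl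
  rw [e, LinearMap.comp_apply, homH_apply]
  change _ = powTensor R ι p (fun i => (x i).right) (rhoPow R ι 2 (seqProd p x).right _)
  rw [seqProd_succ', SemidirectProduct.mul_right, right_seqProd, right_seqProd, MulAut.mul_apply,
    MulAut.inv_apply_self]
  simp [seqProd, List.ofFn_succ]

variable (R ι) in
theorem k0Pow_eq (p : ℕ) : k0Pow R ι p =
    cls (A := pullback R ι (rhoPow R ι (p + 1)))
      (pairK0 (rhoPow R ι (p + 1)) (powCochain R ι p))
      (coboundary_pairK0 _ (coboundary_powCochain R ι p)) := by
  induction p with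
  | zero =>
    refine cls_congr (A := pullback R ι (rhoPow R ι 1)) ?_ _ _
    funext x
    refine Eq.trans ?_ (pairK0_apply (rhoPow R ι 1) _ x).symm
    change toPowOne R ι _ = toPowOne R ι (homologyClass R ((1 : AutF ι) _))
    rfl
  | succ p ih =>
    have hβ : ∀ g a b, LinearMap.id (R := R)
        ((pullback R ι ((rhoPow R ι 2).linHom (rhoPow R ι (p + 1 + 1)))).ρ g a)
        ((pullback R ι (rhoPow R ι 2)).ρ g b) =
        (pullback R ι (rhoPow R ι (p + 1 + 1))).ρ g (LinearMap.id (R := R) a b) :=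
      fun g a b => linHom_apply_apply g.right a b
    have hE := coboundary_inflate ((rhoPow R ι 2).linHom (rhoPow R ι (p + 1 + 1))) _
      (coboundary_powTensor R ι p)
    rw [k0Pow, ih]
    -- The only step valid merely in cohomology: `k₀ ∪ k₀` is exchanged for `-τ₁ ∪ k₀`. The
    -- regroupings on both sides of it are equalities of cochains.
    have key := cls_cupFun_congr
      (A := pullback R ι ((rhoPow R ι 2).linHom (rhoPow R ι (p + 1 + 1))))
      (B := pullback R ι (rhoPow R ι 2)) (C := pullback R ι (rhoPow R ι (p + 1 + 1)))
      LinearMap.id hβ _ _ _ _ hE hE (coboundary_pairK0 _ (coboundary_neg_johnsonFun R ι))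
      (coboundary_k0Sq R ι) rfl (cls_k0Sq R ι)
    refine (cup_cls _ _ _ _ _ (coboundary_k0Fun R ι)).trans (Eq.trans ?_ (key.trans ?_))
    · refine cls_congr (A := pullback R ι (rhoPow R ι (p + 1 + 1))) ?_ _ _
      funext y
      obtain ⟨x, rfl⟩ := exists_seq y
      exact k0Pow_step_left p x
    · refine cls_congr (A := pullback R ι (rhoPow R ι (p + 1 + 1))) ?_ _ _
      funext y
      obtain ⟨x, rfl⟩ := exists_seq y
      exact (k0Pow_step_right p x).symm

end Powers

/-! ### Biadditivity of the cup product. -/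

section Additivity

variable {R G : Type u} [CommRing R] [Group G] {A B C : Rep.{u} R G}

theorem cls_eq_neg_of_add {n : ℕ} {f g : (Fin n → G) → A} (hf : coboundary A n f = 0)
    (hg : coboundary A n g = 0) (h : ∀ hfg : coboundary A n (f + g) = 0, cls (f + g) hfg = 0) :
    cls f hf = -cls g hg := by
  have hfg : coboundary A n (f + g) = 0 := by rw [coboundary_add, hf, hg, add_zero]
  rw [eq_neg_iff_add_eq_zero, ← cls_add f g hf hg hfg, h]

theorem cup_add_left (β : A →ₗ[R] B →ₗ[R] C)
    (hβ : ∀ g a b, β (A.ρ g a) (B.ρ g b) = C.ρ g (β a b)) {p q : ℕ}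
    (x x' : groupCohomology A p) (y : groupCohomology B q) :
    cup β hβ (x + x') y = cup β hβ x y + cup β hβ x' y := by
  obtain ⟨f, hf, rfl⟩ := exists_represents x
  obtain ⟨f', hf', rfl⟩ := exists_represents x'
  obtain ⟨g, hg, rfl⟩ := exists_represents y
  have hff : coboundary A p (f + f') = 0 := by rw [coboundary_add, hf, hf', add_zero]
  have e : cupFun β (f + f') g = cupFun β f g + cupFun β f' g := by
    funext t
    simp [cupFun]
  rw [← cls_add f f' hf hf' hff, cup_cls, cup_cls, cup_cls,
    ← cls_add _ _ _ _ (e ▸ coboundary_cupFun_eq_zero β hβ hff hg)]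
  exact cls_congr e _ _

theorem cup_add_right (β : A →ₗ[R] B →ₗ[R] C)
    (hβ : ∀ g a b, β (A.ρ g a) (B.ρ g b) = C.ρ g (β a b)) {p q : ℕ}
    (x : groupCohomology A p) (y y' : groupCohomology B q) :
    cup β hβ x (y + y') = cup β hβ x y + cup β hβ x y' := by
  obtain ⟨f, hf, rfl⟩ := exists_represents x
  obtain ⟨g, hg, rfl⟩ := exists_represents y
  obtain ⟨g', hg', rfl⟩ := exists_represents y'
  have hgg : coboundary B q (g + g') = 0 := by rw [coboundary_add, hg, hg', add_zero]
  have e : cupFun β f (g + g') = cupFun β f g + cupFun β f g' := by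
    funext t
    simp [cupFun]
  rw [← cls_add g g' hg hg' hgg, cup_cls, cup_cls, cup_cls,
    ← cls_add _ _ _ _ (e ▸ coboundary_cupFun_eq_zero β hβ hf hgg)]
  exact cls_congr e _ _

end Additivity

/-! ### The classes `h_p`, the sign of a change of bracketing, and induction over trees. -/

section Grafting

variable {R ι : Type u} [CommRing R]

theorem graft_zsmul_left {q r : ℕ} (n : ℤ) (x : groupCohomology (homPow R ι (q + 1)) q)
    (y : groupCohomology (homPow R ι (r + 1)) r) :
    graft R ι (n • x) y = n • graft R ι x y :=
  map_zsmul (AddMonoidHom.mk' (fun x => graft R ι x y) fun x x' => by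
    simp only [graft, cup_add_left]) n x

theorem graft_zsmul_right {q r : ℕ} (n : ℤ) (x : groupCohomology (homPow R ι (q + 1)) q)
    (y : groupCohomology (homPow R ι (r + 1)) r) :
    graft R ι x (n • y) = n • graft R ι x y :=
  map_zsmul (AddMonoidHom.mk' (fun y => graft R ι x y) fun y y' => by
    simp only [graft, cup_add_left, cup_add_right]) n y

variable (R ι) in
theorem isGysinImage_k0Pow (p : ℕ) : IsGysinImage (rhoPow R ι (p + 1)) (k0Pow R ι p)
    ((-1 : ℤ) ^ p • cls (A := homPow R ι (p + 1)) (powCochain R ι p)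
      (coboundary_powCochain R ι p)) := by
  rw [k0Pow_eq]
  exact isGysinImage_pairK0 _ _ (isNormalized_powCochain R ι p) (coboundary_powCochain R ι p)

variable (R ι) in
theorem hClass_eq (p : ℕ) : hClass R ι p = (-1 : ℤ) ^ p •
    cls (A := homPow R ι (p + 1)) (powCochain R ι p) (coboundary_powCochain R ι p) :=
  gysin_eq _ (isGysinImage_k0Pow R ι p)

variable (R ι) in
theorem hClass_zero : hClass R ι 0 = oneClass R ι := by
  rw [hClass_eq, pow_zero, one_smul]
  rfl

variable (R ι) in
-- Because `1_H ⊗ 1_H` is the identity of `H^{⊗2}`. The minus sign cancels against the Gysin sign in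
-- degree one, which identifies `h₁` with the class of `τ₁`.
theorem powCochain_one : powCochain R ι 1 = -johnsonFun R ι := by
  funext y
  obtain ⟨x, rfl⟩ := exists_seq y
  have e : tensorHomBilin R ι (rfl : 1 + 1 = 2) (oneHom R ι) (oneHom R ι) = LinearMap.id :=
    HPow.hom_ext₂ fun x y => tensorHomBilin_apply R ι _ _ _ _ _
  change tensorHomBilin R ι (rfl : 1 + 1 = 2) (oneHom R ι)
      ((homPow R ι 1).ρ (seqProd 0 x) (oneHom R ι)) ∘ₗ
    (homPow R ι 2).ρ (seqProd 0 x) ((-johnsonFun R ι) fun j => x (0 + 0 + j)) = _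
  rw [homPow_oneHom, e, LinearMap.id_comp]
  change (homPow R ι 2).ρ 1 _ = _
  rw [map_one]
  change (-johnsonFun R ι) _ = _
  congr 1

variable (R ι) in
theorem hClass_one : hClass R ι 1 =
    cls (A := homPow R ι 2) (johnsonFun R ι) (coboundary_johnsonFun R ι) := by
  rw [hClass_eq, pow_one, neg_one_smul, neg_eq_iff_eq_neg]
  refine (cls_congr (A := homPow R ι 2) (powCochain_one R ι) _
    (coboundary_neg_johnsonFun R ι)).trans ?_
  exact cls_neg (A := homPow R ι 2) _ _ _

theorem graft_cls {q r : ℕ} {f : (Fin q → AutF ι) → (H R ι →ₗ[R] HPow R ι (q + 1))}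
    {g : (Fin r → AutF ι) → (H R ι →ₗ[R] HPow R ι (r + 1))}
    (hf : coboundary (homPow R ι (q + 1)) q f = 0)
    (hg : coboundary (homPow R ι (r + 1)) r g = 0) :
    graft R ι (cls (A := homPow R ι (q + 1)) f hf) (cls (A := homPow R ι (r + 1)) g hg) =
      cls (A := homPow R ι (q + r + 1 + 1)) (graftFun f g (johnsonFun R ι))
        (coboundary_graftFun hf hg (coboundary_johnsonFun R ι)) := by
  have h₁ := cup_cls (A := homPow R ι (q + 1)) (B := homPow R ι (r + 1))
    (C := homPow₂ R ι (q + r + 1 + 1)) (tensorHomBilin R ι (by omega))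
    (tensorHomBilin_equivariant R ι _) f g hf hg
  have h₂ := cup_cls (A := homPow₂ R ι (q + r + 1 + 1)) (B := homPow R ι 2)
    (C := homPow R ι (q + r + 1 + 1)) (compBilin R ι _) (compBilin_equivariant R ι _)
    (tensorFun f g) (johnsonFun R ι) (coboundary_tensorFun hf hg) (coboundary_johnsonFun R ι)
  rw [graft, hClass_one, h₁]
  exact h₂

theorem graftFun_neg {q r : ℕ} (f : (Fin q → AutF ι) → (H R ι →ₗ[R] HPow R ι (q + 1)))
    (g : (Fin r → AutF ι) → (H R ι →ₗ[R] HPow R ι (r + 1)))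
    (t : (Fin 1 → AutF ι) → (H R ι →ₗ[R] HPow R ι 2)) : graftFun f g (-t) = -graftFun f g t := by
  funext y
  obtain ⟨x, rfl⟩ := exists_seq y
  rw [Pi.neg_apply, graftFun_seq, graftFun_seq, Pi.neg_apply, map_neg, LinearMap.comp_neg]

variable (R ι) in
-- The additional Gysin sign cancels the sign of `-τ₁` in `T_{p+1}`. Thus the bracketing entirely to
-- the left gives `h_p` with sign `+1`, and every other tree is compared with it.
theorem hClass_succ (p : ℕ) : hClass R ι (p + 1) = graft R ι (hClass R ι p) (oneClass R ι) := by
  rw [hClass_eq R ι p, graft_zsmul_left, oneClass_eq, graft_cls, hClass_eq, pow_succ, mul_neg_one,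
    neg_smul, ← smul_neg]
  refine congrArg _ (neg_eq_iff_eq_neg.2 ?_)
  have h0 := coboundary_graftFun (coboundary_powCochain R ι p) (coboundary_oneHom R ι)
    (coboundary_johnsonFun R ι)
  have h1 : coboundary (homPow R ι (p + 1 + 1)) (p + 1)
      (-graftFun (powCochain R ι p) (r := 0) (fun _ => oneHom R ι) (johnsonFun R ι)) = 0 :=
    (coboundary_neg _ _ _).trans (neg_eq_zero.2 h0)
  exact (cls_congr (A := homPow R ι (p + 1 + 1)) (graftFun_neg _ _ _) _ h1).trans
    (cls_neg (A := homPow R ι (p + 1 + 1)) _ h0 h1)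

variable (R ι) in
/-- The cocycle `(τ₁ ⊗ 1 + 1 ⊗ τ₁) ∘ τ₁`. -/
def johnsonSq (x : Fin 2 → AutF ι) : H R ι →ₗ[R] HPow R ι 3 :=
  derivation (johnson₁ R ι (x 0)) ∘ₗ (homPow R ι 2).ρ (x 0) (johnson₁ R ι (x 1))

variable (R ι) in
-- This makes `(h₁ ⊗ 1 + 1 ⊗ h₁) ∘ h₁` vanish, the one relation behind all the signs.
theorem coboundary_johnson₂ :
    coboundary (homPow R ι 3) 1 (-fun x => johnson₂ R ι (x 0)) = johnsonSq R ι := by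
  refine (coboundary_neg (homPow R ι 3) 1 _).trans (neg_eq_iff_eq_neg.2 ?_)
  funext x
  rw [coboundary_degree_one]
  exact johnson₂_mul R ι (x 0) (x 1)

theorem seqProd_add {G : Type u} [Group G] (p q : ℕ) (x : ℕ → G) :
    seqProd (p + q) x = seqProd p x * seqProd q fun i => x (p + i) := by
  induction q with
  | zero => exact (mul_one _).symm
  | succ q ih => rw [← add_assoc, seqProd_succ', ih, seqProd_succ', mul_assoc]

theorem homPow_derivation_comp (φ : AutF ι) (t u : H R ι →ₗ[R] HPow R ι 2) :
    (homPow R ι 3).ρ φ (derivation t ∘ₗ u) =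
      derivation ((homPow R ι 2).ρ φ t) ∘ₗ (homPow R ι 2).ρ φ u :=
  H.hom_ext fun γ => by
    rw [homH_apply, LinearMap.comp_apply, LinearMap.comp_apply, homH_apply, derivation_equivariant]

theorem homPow_tensorHomBilin_oneHom_comp {b c : ℕ} (h : b + 1 = c) (φ : AutF ι)
    (v : H R ι →ₗ[R] HPow R ι b) (u : H R ι →ₗ[R] HPow R ι 2) :
    (homPow R ι c).ρ φ (tensorHomBilin R ι h v (oneHom R ι) ∘ₗ u) =
      tensorHomBilin R ι h ((homPow R ι b).ρ φ v) (oneHom R ι) ∘ₗ (homPow R ι 2).ρ φ u := by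
  have h₁ := tensorHomBilin_equivariant R ι h φ v (oneHom R ι)
  rw [homPow_oneHom] at h₁
  rw [h₁]
  exact (compBilin_equivariant R ι c φ (tensorHomBilin R ι h v (oneHom R ι)) u).symm

/-- `(f ∪ (g ∪ τ₁)) ∪ τ₁ + ((f ∪ g) ∪ τ₁) ∪ τ₁ = (f ∪ g) ∪ ((τ₁ ⊗ 1 + 1 ⊗ τ₁) ∘ τ₁)`, with the
evident contractions of coefficients. -/
theorem graftFun_graftFun_add {q r : ℕ} (f : (Fin q → AutF ι) → (H R ι →ₗ[R] HPow R ι (q + 1)))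
    (g : (Fin r → AutF ι) → (H R ι →ₗ[R] HPow R ι (r + 1))) :
    (graftFun f (graftFun g (r := 0) (fun _ => oneHom R ι) (johnsonFun R ι)) (johnsonFun R ι) +
      graftFun (graftFun f g (johnsonFun R ι)) (r := 0) (fun _ => oneHom R ι) (johnsonFun R ι) :
        (Fin (q + r + 1 + 1) → AutF ι) → (H R ι →ₗ[R] HPow R ι (q + r + 1 + 1 + 1))) =
    cupFun (A := Rep.of ((rhoPow R ι 3).linHom (rhoPow R ι (q + r + 1 + 1 + 1))))
      (B := homPow R ι 3) (C := homPow R ι (q + r + 1 + 1 + 1)) (LinearMap.llcomp R _ _ _)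
      (cupFun (A := homPow R ι (q + 1)) (B := homPow R ι (r + 1))
        (C := Rep.of ((rhoPow R ι 3).linHom (rhoPow R ι (q + r + 1 + 1 + 1))))
        (tensorHomOneBilin (by omega)) f g) (johnsonSq R ι) := by
  funext y
  obtain ⟨x, rfl⟩ := exists_seq y
  -- Both summands feed the arguments in the same order to `f`, `g`, `τ₁`, `τ₁`, so no sign arises
  -- from reordering. With `u`, `v`, `t`, `s` the four values, already translated by the preceding
  -- arguments, the claim is `tensorHom_derivation` composed with `s`.
  set P := seqProd (q + r) x with hP
  set t := (homPow R ι 2).ρ P (johnson₁ R ι (x (q + r))) with ht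
  set s := (homPow R ι 2).ρ (seqProd (q + r + 1) x) (johnson₁ R ι (x (q + r + 1))) with hs
  set u := f fun i => x i
  set v := (homPow R ι (r + 1)).ρ (seqProd q x) (g fun j => x (q + j)) with hv
  have h₁ : (graftFun f (graftFun g (r := 0) (fun _ => oneHom R ι) (johnsonFun R ι))
      (johnsonFun R ι) fun i => x i) =
      tensorHomBilin R ι (c := q + r + 1 + 1 + 1) (by omega) u
        (tensorHomBilin R ι (c := r + 1 + 1) (by omega) v (oneHom R ι) ∘ₗ t) ∘ₗ s := by
    have e : (homPow R ι (r + 1 + 1)).ρ (seqProd q x)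
        (graftFun g (r := 0) (fun _ => oneHom R ι) (johnsonFun R ι) fun j => x (q + j)) =
        tensorHomBilin R ι (c := r + 1 + 1) (by omega) v (oneHom R ι) ∘ₗ t := by
      rw [graftFun_seq _ _ _ fun j => x (q + j), tensorFun_seq _ _ fun j => x (q + j),
        homPow_oneHom]
      refine (homPow_tensorHomBilin_oneHom_comp _ _ _ _).trans ?_
      have eP : P = seqProd q x * seqProd r fun j => x (q + j) := seqProd_add q r x
      rw [ht, eP, map_mul]
      rfl
    rw [← e]
    rfl
  have h₂ : (graftFun (graftFun f g (johnsonFun R ι)) (r := 0) (fun _ => oneHom R ι)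
      (johnsonFun R ι) fun i => x i) =
      tensorHomBilin R ι (c := q + r + 1 + 1 + 1) (by omega)
        (tensorHomBilin R ι (c := q + r + 1 + 1) (by omega) u v ∘ₗ t) (oneHom R ι) ∘ₗ s := by
    rw [graftFun_seq, tensorFun_seq, homPow_oneHom]
    rfl
  have h₃ : (homPow R ι 3).ρ P (johnsonSq R ι fun j => x (q + r + j)) = derivation t ∘ₗ s := by
    refine (homPow_derivation_comp _ _ _).trans ?_
    rw [hs, seqProd_succ', map_mul]
    rfl
  refine (congrArg₂ (· + ·) h₁ h₂).trans (Eq.trans ?_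
    (congrArg (fun z => tensorHomOneBilin (by omega) u v ∘ₗ z) h₃).symm)
  rw [← LinearMap.comp_assoc, ← tensorHom_derivation (b' := r + 1 + 1) (c := q + r + 1 + 1) u v t
    (by omega) (by omega) (by omega) (by omega) (by omega), LinearMap.add_comp]

variable (R ι) in
theorem coboundary_johnsonSq : coboundary (homPow R ι 3) 2 (johnsonSq R ι) = 0 := by
  rw [← coboundary_johnson₂]
  exact coboundary_coboundary _ _

variable (R ι) in
theorem cls_johnsonSq :
    cls (A := homPow R ι 3) (johnsonSq R ι) (coboundary_johnsonSq R ι) = 0 :=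
  (cls_eq_zero_iff (A := homPow R ι 3) _ _).2 ⟨_, coboundary_johnson₂ R ι⟩

theorem llcomp_equivariant (m : ℕ) (φ : AutF ι) (a : HPow R ι 3 →ₗ[R] HPow R ι m)
    (b : H R ι →ₗ[R] HPow R ι 3) :
    LinearMap.llcomp R (H R ι) (HPow R ι 3) (HPow R ι m)
        ((rhoPow R ι 3).linHom (rhoPow R ι m) φ a) ((homPow R ι 3).ρ φ b) =
      (homPow R ι m).ρ φ (LinearMap.llcomp R (H R ι) (HPow R ι 3) (HPow R ι m) a b) :=
  H.hom_ext fun γ => by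
    rw [homH_apply, LinearMap.llcomp_apply, LinearMap.llcomp_apply, homH_apply,
      linHom_apply_apply]

section

variable {q r : ℕ} {f : (Fin q → AutF ι) → (H R ι →ₗ[R] HPow R ι (q + 1))}
  {g : (Fin r → AutF ι) → (H R ι →ₗ[R] HPow R ι (r + 1))}

theorem cls_graftFun_graftFun_add (hf : coboundary (homPow R ι (q + 1)) q f = 0)
    (hg : coboundary (homPow R ι (r + 1)) r g = 0)
    (h : coboundary (homPow R ι (q + r + 1 + 1 + 1)) (q + r + 1 + 1)
      (graftFun (q := q) (r := r + 1) f
          (graftFun (q := r) (r := 0) g (fun _ => oneHom R ι) (johnsonFun R ι)) (johnsonFun R ι) +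
        graftFun (q := q + r + 1) (r := 0) (graftFun f g (johnsonFun R ι)) (fun _ => oneHom R ι)
          (johnsonFun R ι)) = 0) :
    cls (A := homPow R ι (q + r + 1 + 1 + 1)) _ h = 0 := by
  let E : Rep.{u} R (AutF ι) := Rep.of ((rhoPow R ι 3).linHom (rhoPow R ι (q + r + 1 + 1 + 1)))
  have hE := coboundary_cupFun_eq_zero (A := homPow R ι (q + 1)) (B := homPow R ι (r + 1)) (C := E)
    (tensorHomOneBilin (by omega)) (tensorHomOneBilin_equivariant _) hf hg
  have h0 := cls_cupFun_right (A := E) (B := homPow R ι 3) (C := homPow R ι (q + r + 1 + 1 + 1))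
    _ (llcomp_equivariant _) _ (johnsonSq R ι) hE (coboundary_johnsonSq R ι) (cls_johnsonSq R ι)
  exact (cls_congr (A := homPow R ι (q + r + 1 + 1 + 1)) (graftFun_graftFun_add f g) _ _).trans h0

theorem coboundary_graftFun_one (hg : coboundary (homPow R ι (r + 1)) r g = 0) :
    coboundary (homPow R ι (r + 1 + 1)) (r + 1)
      (graftFun (q := r) (r := 0) g (fun _ => oneHom R ι) (johnsonFun R ι)) = 0 :=
  coboundary_graftFun hg (coboundary_oneHom R ι) (coboundary_johnsonFun R ι)

theorem graft_cls_one (hg : coboundary (homPow R ι (r + 1)) r g = 0) :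
    (graft R ι (q := r) (r := 0) (cls (A := homPow R ι (r + 1)) g hg) (oneClass R ι) :
      groupCohomology (homPow R ι (r + 1 + 1)) (r + 1)) =
    cls (A := homPow R ι (r + 1 + 1))
      (graftFun (q := r) (r := 0) g (fun _ => oneHom R ι) (johnsonFun R ι))
      (coboundary_graftFun_one hg) :=
  graft_cls hg (coboundary_oneHom R ι)

end

/-- The sum of the two bracketings is a product whose last factor is the exact cocycle `(τ₁ ⊗ 1 + 1
⊗ τ₁) ∘ τ₁`. -/
theorem graft_graft_one {q r : ℕ} (x : groupCohomology (homPow R ι (q + 1)) q)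
    (y : groupCohomology (homPow R ι (r + 1)) r) :
    (graft R ι (q := q) (r := r + 1) x (graft R ι (q := r) (r := 0) y (oneClass R ι)) :
      groupCohomology (homPow R ι (q + r + 1 + 1 + 1)) (q + r + 1 + 1)) =
    -graft R ι (q := q + r + 1) (r := 0) (graft R ι x y) (oneClass R ι) := by
  obtain ⟨f, hf, rfl⟩ := exists_represents x
  obtain ⟨g, hg, rfl⟩ := exists_represents y
  have hl := coboundary_graftFun (q := q) (r := r + 1) hf (coboundary_graftFun_one hg)
    (coboundary_johnsonFun R ι)
  have hfg := coboundary_graftFun hf hg (coboundary_johnsonFun R ι)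
  have hr := coboundary_graftFun_one hfg
  rw [graft_cls_one, graft_cls, graft_cls hf hg, graft_cls_one]
  exact cls_eq_neg_of_add hl hr (cls_graftFun_graftFun_add hf hg)

/-- The last letter of `h_r` is split off by `hClass_succ` and moved outside at the price of one
sign; after `r` such moves the second factor is `h₀ = 1_H`. -/
theorem graft_hClass (q r : ℕ) :
    graft R ι (hClass R ι q) (hClass R ι r) = (-1 : ℤ) ^ r • hClass R ι (q + r + 1) := by
  induction r with
  | zero => rw [hClass_zero, pow_zero, one_smul, ← hClass_succ]
  | succ r ih =>
    rw [hClass_succ]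
    refine (graft_graft_one _ _).trans ?_
    rw [ih, graft_zsmul_left, ← hClass_succ, pow_succ, mul_neg_one, neg_smul]
    rfl

/-- The signs of the two subtrees come out by biadditivity, and joining them contributes
`(-1)^{|w₂|}`, which is the recursion for `Vertex.sgn`. -/
theorem Vertex.h_eq {p : ℕ} (w : Vertex p) : w.h R ι = w.sgn • hClass R ι p := by
  induction w with
  | letter => rw [Vertex.h, Vertex.sgn, one_smul, hClass_zero]
  | pair w₁ w₂ h₁ h₂ =>
    rw [Vertex.h, Vertex.sgn, h₁, h₂, graft_zsmul_left, graft_zsmul_right, graft_hClass, smul_smul,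
      smul_smul]
    congr 1
    ring

end Grafting

end KawazumiMagnus

end

theorem proposition4p3 {R ι : Type u} [CommRing R] [Fintype ι] (hι : 2 ≤ Fintype.card ι) :
    (∀ q : ℕ, ∃! d : groupCohomology (KawazumiMagnus.homPow R ι (q + 1)) q,
      KawazumiMagnus.IsGysinImage (KawazumiMagnus.rhoPow R ι (q + 1))
        (KawazumiMagnus.k0Pow R ι q) d) ∧
    ∀ (p : ℕ) (w : KawazumiMagnus.Vertex p),
      w.h R ι = w.sgn • KawazumiMagnus.hClass R ι p :=
  ⟨fun q => ⟨_, KawazumiMagnus.isGysinImage_k0Pow R ι q, fun _ h =>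
    h.unique _ (KawazumiMagnus.isGysinImage_k0Pow R ι q)⟩, fun _ w => w.h_eq⟩
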